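/- Let $\lambda_1,\lambda_2>0$ and $K\ge 4$ be real numbers. For an irrational $\beta\in[0,1]$ put $a_\beta(n)=(\lambda_1-\lambda_2)\bigl(\lfloor (n+1)\beta\rfloor-\lfloor n\beta\rfloor\bigr)+\lambda_2$ for $n\in\mathbb Z$, where $\lfloor x\rfloor$ is the largest integer not exceeding $x$, and let $H=H_\beta$ be the bounded self-adjoint operator on $\ell^2(\mathbb Z)$ (the off-diagonal Sturmian operator) $$H\psi(n)=a_\beta(n)\psi(n+1)+a_\beta(n-1)\psi(n-1),\qquad n\in\mathbb Z .$$ Let $(\delta_n)_{n\in\mathbb Z}$ be the canonical basis of $\ell^2(\mathbb Z)$, let $$P(N,t)=\sum_{|n|>N}\bigl|\langle e^{-itH}\delta_1,\delta_n\rangle\bigr|^2$$ be the outside probabilities, and let $$\Phi(n,z)=T_n(z)\cdots T_1(z),\qquad T_n(z)=\frac1{a_\beta(n)}\begin{pmatrix} z&-1\\ a_\beta(n)^2&0\end{pmatrix}\qquad(n\ge1,\ z\in\mathbb C)$$ be the transfer matrices, with $\|\cdot\|$ the operator norm on Euclidean $\mathbb C^2$. Then there are constants $C,d>0$, depending only on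 $\lambda_1,\lambda_2$ and $K$, such that for every irrational $\beta\in[0,1]$ with $\sigma(H_\beta)\subset[-K+1,K-1]$, every integer $N\ge1$ and every real $t>0$, $$P(N,t)\le C\left(e^{-dN}+t^4\int_{-K}^{K}\Bigl(\max_{1\le n\le N}\bigl\|\Phi(n,E+\tfrac it)\bigr\|^2\Bigr)^{-1}dE\right).$$ -/

import Mathlib

open scoped Matrix.Norms.L2Operator

noncomputable section

/-- The Hilbert space `ℓ²(ℤ)` of square-summable complex sequences indexed by `ℤ`. -/
abbrev EllTwo : Type := lp (fun _ : ℤ => ℂ) 2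

/-- The canonical basis vector `δ_n` of `ℓ²(ℤ)`. -/
def delta (n : ℤ) : EllTwo := lp.single 2 n (1 : ℂ)

lemma weightedShift_memlp_and_norm {c : ℤ → ℝ} {C : ℝ} (hc : ∀ n, |c n| ≤ C) (k : ℤ)
    (ψ : EllTwo) :
    ∃ h : Memℓp (fun n : ℤ => (c n : ℂ) * ψ (n + k)) 2,
      ‖(⟨fun n : ℤ => (c n : ℂ) * ψ (n + k), h⟩ : EllTwo)‖ ≤ C * ‖ψ‖ := by
  have hC : 0 ≤ C := (abs_nonneg _).trans (hc 0)
  have h2 : (0 : ℝ) < (2 : ENNReal).toReal := by norm_num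
  have hs : Summable fun n : ℤ => ‖ψ n‖ ^ (2 : ENNReal).toReal :=
    (lp.memℓp ψ).summable h2
  have hs' : Summable fun n : ℤ => ‖ψ (n + k)‖ ^ (2 : ENNReal).toReal :=
    (Equiv.addRight k).summable_iff.mpr hs
  have hle : ∀ n : ℤ, ‖(c n : ℂ) * ψ (n + k)‖ ^ (2 : ENNReal).toReal
      ≤ C ^ (2 : ENNReal).toReal * ‖ψ (n + k)‖ ^ (2 : ENNReal).toReal := by
    intro n
    rw [← Real.mul_rpow hC (norm_nonneg _), norm_mul, Complex.norm_real, Real.norm_eq_abs]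
    exact Real.rpow_le_rpow (by positivity)
      (mul_le_mul_of_nonneg_right (hc n) (norm_nonneg _)) h2.le
  have hsum : Summable fun n : ℤ => ‖(c n : ℂ) * ψ (n + k)‖ ^ (2 : ENNReal).toReal :=
    Summable.of_nonneg_of_le (fun n => by positivity) hle (hs'.mul_left _)
  refine ⟨memℓp_gen hsum, lp.norm_le_of_tsum_le h2 (by positivity) ?_⟩
  calc ∑' n : ℤ, ‖(c n : ℂ) * ψ (n + k)‖ ^ (2 : ENNReal).toReal
      ≤ ∑' n : ℤ, C ^ (2 : ENNReal).toReal * ‖ψ (n + k)‖ ^ (2 : ENNReal).toReal :=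
        hsum.tsum_le_tsum hle (hs'.mul_left _)
    _ = C ^ (2 : ENNReal).toReal * ∑' n : ℤ, ‖ψ (n + k)‖ ^ (2 : ENNReal).toReal := tsum_mul_left
    _ = C ^ (2 : ENNReal).toReal * ∑' n : ℤ, ‖ψ n‖ ^ (2 : ENNReal).toReal := by
        rw [(Equiv.addRight k).tsum_eq (fun n : ℤ => ‖ψ n‖ ^ (2 : ENNReal).toReal) |>.symm]
        rfl
    _ = (C * ‖ψ‖) ^ (2 : ENNReal).toReal := by
        rw [Real.mul_rpow hC (norm_nonneg _), lp.norm_rpow_eq_tsum h2]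

/-- For a bounded real sequence `c`, the bounded operator `ψ ↦ (n ↦ c n * ψ (n + k))`
on `ℓ²(ℤ)`. -/
def weightedShift (c : ℤ → ℝ) (hc : ∃ C : ℝ, ∀ n, |c n| ≤ C) (k : ℤ) : EllTwo →L[ℂ] EllTwo :=
  LinearMap.mkContinuousOfExistsBound
    { toFun := fun ψ => ⟨fun n : ℤ => (c n : ℂ) * ψ (n + k),
        (weightedShift_memlp_and_norm hc.choose_spec k ψ).1⟩
      map_add' := fun ψ φ => by
        ext n
        exact mul_add (c n : ℂ) (ψ (n + k)) (φ (n + k))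
      map_smul' := fun s ψ => by
        ext n
        simp [mul_left_comm] }
    ⟨hc.choose, fun ψ => (weightedShift_memlp_and_norm hc.choose_spec k ψ).2⟩

/-- The Jacobi operator
`H ψ(n) = a(n) ψ(n+1) + a(n-1) ψ(n-1) + b(n) ψ(n)` on `ℓ²(ℤ)`, for bounded real sequences
`a`, `b` (see `jacobiOperator_apply`). -/
def jacobiOperator (a b : ℤ → ℝ) (ha : ∃ C : ℝ, ∀ n, |a n| ≤ C)
    (hb : ∃ C : ℝ, ∀ n, |b n| ≤ C) : EllTwo →L[ℂ] EllTwo :=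
  weightedShift a ha 1
    + weightedShift (fun n => a (n - 1)) (ha.imp fun _ h n => h (n - 1)) (-1)
    + weightedShift b hb 0

theorem jacobiOperator_apply (a b : ℤ → ℝ) (ha : ∃ C : ℝ, ∀ n, |a n| ≤ C)
    (hb : ∃ C : ℝ, ∀ n, |b n| ≤ C) (ψ : EllTwo) (n : ℤ) :
    jacobiOperator a b ha hb ψ n
      = (a n : ℂ) * ψ (n + 1) + (a (n - 1) : ℂ) * ψ (n - 1) + (b n : ℂ) * ψ n := by
  have h : jacobiOperator a b ha hb ψ n
      = (a n : ℂ) * ψ (n + 1) + (a (n - 1) : ℂ) * ψ (n + -1) + (b n : ℂ) * ψ (n + 0) := rfl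
  rw [h, add_zero, ← sub_eq_add_neg]

/-- The off-diagonal Sturmian sequence
`a(n) = (l₁ - l₂) (⌊(n+1) β⌋ - ⌊n β⌋) + l₂`. -/
def sturmianHopping (l₁ l₂ β : ℝ) (n : ℤ) : ℝ :=
  (l₁ - l₂) * ((⌊((n : ℝ) + 1) * β⌋ - ⌊(n : ℝ) * β⌋ : ℤ) : ℝ) + l₂

lemma sturmianHopping_bounded (l₁ l₂ β : ℝ) :
    ∃ C : ℝ, ∀ n, |sturmianHopping l₁ l₂ β n| ≤ C := by
  refine ⟨|l₁ - l₂| * (|β| + 1) + |l₂|, fun n => ?_⟩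
  have h : |((⌊((n : ℝ) + 1) * β⌋ - ⌊(n : ℝ) * β⌋ : ℤ) : ℝ)| ≤ |β| + 1 := by
    push_cast
    have h1 := Int.floor_le (((n : ℝ) + 1) * β)
    have h2 := Int.lt_floor_add_one (((n : ℝ) + 1) * β)
    have h3 := Int.floor_le ((n : ℝ) * β)
    have h4 := Int.lt_floor_add_one ((n : ℝ) * β)
    have h5 := le_abs_self β
    have h6 := neg_abs_le β
    rw [abs_le]
    constructor <;> linarith
  unfold sturmianHopping
  refine (abs_add_le _ _).trans ?_
  rw [abs_mul]
  gcongr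

/-- The off-diagonal Sturmian operator: the Jacobi operator with the hopping sequence
`sturmianHopping l₁ l₂ β` and `b = 0`. -/
def sturmianOperator (l₁ l₂ β : ℝ) : EllTwo →L[ℂ] EllTwo :=
  jacobiOperator (sturmianHopping l₁ l₂ β) (fun _ => 0) (sturmianHopping_bounded l₁ l₂ β)
    ⟨0, fun _ => by simp⟩

/-- The unitary group `e^{-itH}` of a bounded self-adjoint operator `H`, given by the
exponential series. -/
def evolution (H : EllTwo →L[ℂ] EllTwo) (t : ℝ) : EllTwo →L[ℂ] EllTwo :=
  NormedSpace.exp ((-(Complex.I * (t : ℂ))) • H)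

/-- `a(n,t) = |⟨e^{-itH} δ_1, δ_n⟩|²`, the probability of being at site `n` at time `t`. -/
def siteProb (H : EllTwo →L[ℂ] EllTwo) (n : ℤ) (t : ℝ) : ℝ :=
  ‖inner ℂ (delta n) (evolution H t (delta 1))‖ ^ 2

/-- The outside probability `P(N,t) = ∑_{|n| > N} a(n,t)`. -/
def outsideProb (H : EllTwo →L[ℂ] EllTwo) (N : ℕ) (t : ℝ) : ℝ :=
  ∑' n : {n : ℤ // (N : ℤ) < |n|}, siteProb H n t

/-- The one-step matrix `T_n(z) = a(n)⁻¹ [[z, -1], [a(n)², 0]]`, which maps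
`(ψ(n), a(n-1) ψ(n-1))` to `(ψ(n+1), a(n) ψ(n))` for solutions of `Hψ = zψ` with `b = 0`. -/
def stepMatrix (a : ℤ → ℝ) (n : ℤ) (z : ℂ) : Matrix (Fin 2) (Fin 2) ℂ :=
  ((a n : ℂ)⁻¹) • !![z, -1; (a n : ℂ) ^ 2, 0]

/-- The transfer matrix `Φ(n,z) = T_n(z) ⋯ T_1(z)`. -/
def transferMatrix (a : ℤ → ℝ) : ℕ → ℂ → Matrix (Fin 2) (Fin 2) ℂ
  | 0, _ => 1
  | n + 1, z => stepMatrix a ((n : ℤ) + 1) z * transferMatrix a n z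

/-- `max_{1 ≤ n ≤ N} ‖Φ(n,z)‖²`, with the operator norm of `2 × 2` matrices acting on
Euclidean `ℂ²`. -/
def maxTransferNormSq (a : ℤ → ℝ) (N : ℕ) (hN : 1 ≤ N) (z : ℂ) : ℝ :=
  (Finset.Icc 1 N).sup' (Finset.nonempty_Icc.mpr hN) fun n => ‖transferMatrix a n z‖ ^ 2

end

/-!
The Cauchy integral of `e^{-itz} ⟨δ_n, (z - H)⁻¹ δ_1⟩` over the boundary of a rectangle around
`σ(H)` is `2πi ⟨δ_n, e^{-itH} δ_1⟩`. The two vertical sides and the bottom side lie at distance at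
least `1` from the spectrum, and the Combes–Thomas estimate makes their contribution exponentially
small in `|n|`. The top side is put at height `1/t`, so that `e^{-itz}` stays bounded there.

Removing the bond `(k, k+1)` of the Jacobi operator shows that the `n`-th entries with `n > k` of
`(z - H)⁻¹ δ_1` are the product of the `k`-th entry of the resolvent decoupled at `k` and of the
resolvent started at `k+1`. The decoupled resolvent solves the recurrence of the transfer matrices
with a boundary condition at `k`, so `det Φ(k,z) = 1` bounds the first row of `Φ(k,z)` times its
`k`-th entry by a multiple of `1 / |Im z|`. The second row of `Φ(k,z)` is `a(k)` times the first row
of `Φ(k-1,z)`, whence `‖Φ(k,z)‖²` times the outside mass of the resolvent is at most a multiple of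
`1 / |Im z|⁴`. The left half-line is treated by reflection, which does not change the values of a
Sturmian sequence at the sites `n ≥ 1`.
-/

noncomputable section

section RectangleIntegral

open Complex Set Interval

variable {E F : Type*} [NormedAddCommGroup E] [NormedAddCommGroup F] {a b c d : ℝ} {f g : ℂ → E}

/-- The boundary of the rectangle with opposite corners `a + c i` and `b + d i`. -/
def rectBoundary (a b c d : ℝ) : Set ℂ :=
  ([[a, b]] ×ℂ {c, d}) ∪ ({a, b} ×ℂ [[c, d]])

lemma mem_rectBoundary_of_mem_uIcc_re {x y : ℝ} (hx : x ∈ [[a, b]]) (hy : y = c ∨ y = d) :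
    (x + y * I : ℂ) ∈ rectBoundary a b c d :=
  Or.inl ⟨by simpa using hx, by simpa using hy⟩

lemma mem_rectBoundary_of_mem_uIcc_im {x y : ℝ} (hx : x = a ∨ x = b) (hy : y ∈ [[c, d]]) :
    (x + y * I : ℂ) ∈ rectBoundary a b c d :=
  Or.inr ⟨by simpa using hx, by simpa using hy⟩

lemma intervalIntegrable_horizontal_of_continuousOn_rectBoundary
    (hf : ContinuousOn f (rectBoundary a b c d)) {y : ℝ} (hy : y = c ∨ y = d) :
    IntervalIntegrable (fun x : ℝ => f (x + y * I)) MeasureTheory.volume a b :=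
  (hf.comp (f := fun x : ℝ => (x + y * I : ℂ)) (by fun_prop)
    fun _ hx => mem_rectBoundary_of_mem_uIcc_re hx hy).intervalIntegrable

lemma intervalIntegrable_vertical_of_continuousOn_rectBoundary
    (hf : ContinuousOn f (rectBoundary a b c d)) {x : ℝ} (hx : x = a ∨ x = b) :
    IntervalIntegrable (fun y : ℝ => f (x + y * I)) MeasureTheory.volume c d :=
  (hf.comp (f := fun y : ℝ => (x + y * I : ℂ)) (by fun_prop)
    fun _ hy => mem_rectBoundary_of_mem_uIcc_im hx hy).intervalIntegrable

variable [NormedSpace ℂ E] [NormedSpace ℂ F]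

/-- The counterclockwise contour integral of `f` along the boundary of the rectangle with lower
left corner `a + c i` and upper right corner `b + d i`. -/
def rectIntegral (f : ℂ → E) (a b c d : ℝ) : E :=
  (∫ x : ℝ in a..b, f (x + c * I)) - (∫ x : ℝ in a..b, f (x + d * I))
    + I • (∫ y : ℝ in c..d, f (b + y * I)) - I • ∫ y : ℝ in c..d, f (a + y * I)

lemma rectIntegral_congr (h : EqOn f g (rectBoundary a b c d)) :
    rectIntegral f a b c d = rectIntegral g a b c d := by
  have horizontal : ∀ y : ℝ, y = c ∨ y = d →
      (∫ x : ℝ in a..b, f (x + y * I)) = ∫ x : ℝ in a..b, g (x + y * I) := fun y hy =>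
    intervalIntegral.integral_congr fun x hx => h (mem_rectBoundary_of_mem_uIcc_re hx hy)
  have vertical : ∀ x : ℝ, x = a ∨ x = b →
      (∫ y : ℝ in c..d, f (x + y * I)) = ∫ y : ℝ in c..d, g (x + y * I) := fun x hx =>
    intervalIntegral.integral_congr fun y hy => h (mem_rectBoundary_of_mem_uIcc_im hx hy)
  rw [rectIntegral, rectIntegral, horizontal c (.inl rfl), horizontal d (.inr rfl),
    vertical b (.inr rfl), vertical a (.inl rfl)]

lemma rectIntegral_add (hf : ContinuousOn f (rectBoundary a b c d))
    (hg : ContinuousOn g (rectBoundary a b c d)) :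
    rectIntegral (fun z => f z + g z) a b c d
      = rectIntegral f a b c d + rectIntegral g a b c d := by
  have horizontal := fun {h : ℂ → E} (hh : ContinuousOn h (rectBoundary a b c d)) {y : ℝ} hy =>
    intervalIntegrable_horizontal_of_continuousOn_rectBoundary (y := y) hh hy
  have vertical := fun {h : ℂ → E} (hh : ContinuousOn h (rectBoundary a b c d)) {x : ℝ} hx =>
    intervalIntegrable_vertical_of_continuousOn_rectBoundary (x := x) hh hx
  simp only [rectIntegral]
  rw [intervalIntegral.integral_add (horizontal hf (.inl rfl)) (horizontal hg (.inl rfl)),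
    intervalIntegral.integral_add (horizontal hf (.inr rfl)) (horizontal hg (.inr rfl)),
    intervalIntegral.integral_add (vertical hf (.inr rfl)) (vertical hg (.inr rfl)),
    intervalIntegral.integral_add (vertical hf (.inl rfl)) (vertical hg (.inl rfl)),
    smul_add, smul_add]
  abel

lemma rectIntegral_clm_comp [CompleteSpace E] [CompleteSpace F] (L : E →L[ℂ] F)
    (hf : ContinuousOn f (rectBoundary a b c d)) :
    rectIntegral (fun z => L (f z)) a b c d = L (rectIntegral f a b c d) := by
  have horizontal := fun {y : ℝ} hy => L.intervalIntegral_comp_comm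
    (intervalIntegrable_horizontal_of_continuousOn_rectBoundary (y := y) hf hy)
  have vertical := fun {x : ℝ} hx => L.intervalIntegral_comp_comm
    (intervalIntegrable_vertical_of_continuousOn_rectBoundary (x := x) hf hx)
  simp only [rectIntegral, map_add, map_sub, map_smul]
  rw [horizontal (.inl rfl), horizontal (.inr rfl), vertical (.inr rfl), vertical (.inl rfl)]

lemma norm_rectIntegral_le (f : ℂ → E) (a b c d : ℝ) :
    ‖rectIntegral f a b c d‖ ≤ ‖∫ x : ℝ in a..b, f (x + c * I)‖ + ‖∫ x : ℝ in a..b, f (x + d * I)‖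
      + ‖∫ y : ℝ in c..d, f (b + y * I)‖ + ‖∫ y : ℝ in c..d, f (a + y * I)‖ := by
  refine (norm_sub_le _ _).trans (add_le_add ((norm_add_le _ _).trans (add_le_add
    (norm_sub_le _ _) ?_)) ?_) <;> rw [norm_smul, norm_I, one_mul]

lemma integral_inv_of_mem_slitPlane {p v : ℂ} {a b : ℝ}
    (h : ∀ s ∈ [[a, b]], p + s * v ∈ slitPlane) :
    v * ∫ s : ℝ in a..b, (p + s * v)⁻¹ = log (p + b * v) - log (p + a * v) := by
  rw [← intervalIntegral.integral_const_mul]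
  refine intervalIntegral.integral_eq_sub_of_hasDerivAt
    (f := fun s : ℝ => log (p + s * v)) (fun s hs => ?_) ?_
  · have line : HasDerivAt (fun s : ℝ => p + (s : ℂ) * v) v s := by
      simpa using ((ofRealCLM.hasDerivAt (x := s)).mul_const v).const_add p
    simpa [div_eq_mul_inv] using line.clog_real (h s hs)
  · exact (continuousOn_const.mul (ContinuousOn.inv₀ (by fun_prop)
      fun s hs => slitPlane_ne_zero (h s hs))).intervalIntegrable

lemma log_sub_log_neg_of_im_pos {w : ℂ} (hw : 0 < w.im) : log w - log (-w) = Real.pi * I := by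
  rw [log, log, arg_neg_eq_arg_sub_pi_of_im_pos hw, norm_neg]
  push_cast
  ring

-- The logarithm is continuous along three edges; on the left edge, which crosses the branch cut,
-- `z ↦ log (-z)` is used instead, and each of the two left corners contributes `π i`.
lemma rectIntegral_inv (ha : a < 0) (hb : 0 < b) (hc : c < 0) (hd : 0 < d) :
    rectIntegral (fun z => z⁻¹) a b c d = 2 * Real.pi * I := by
  have horizontal : ∀ y : ℝ, y ≠ 0 →
      (∫ x : ℝ in a..b, (x + y * I : ℂ)⁻¹) = log (b + y * I) - log (a + y * I) := by
    intro y hy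
    simpa [add_comm] using integral_inv_of_mem_slitPlane (p := y * I) (v := 1) (a := a) (b := b)
      fun _ _ => Or.inr (by simpa using hy)
  have right : I * (∫ y : ℝ in c..d, (b + y * I : ℂ)⁻¹) = log (b + d * I) - log (b + c * I) :=
    integral_inv_of_mem_slitPlane fun _ _ => Or.inl (by simpa using hb)
  have left : I * (∫ y : ℝ in c..d, (a + y * I : ℂ)⁻¹)
      = log (-(a + d * I)) - log (-(a + c * I)) := by
    have := integral_inv_of_mem_slitPlane (p := -a) (v := -I) (a := c) (b := d)
      fun _ _ => Or.inl (by simpa using ha)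
    rw [neg_mul, ← mul_neg, ← intervalIntegral.integral_neg] at this
    simpa only [← inv_neg, mul_neg, neg_add_rev, neg_neg, add_comm] using this
  have upper_left := log_sub_log_neg_of_im_pos (w := a + d * I) (by simpa using hd)
  have lower_left := log_sub_log_neg_of_im_pos (w := -(a + c * I)) (by simpa using hc)
  rw [neg_neg] at lower_left
  rw [rectIntegral, horizontal c hc.ne, horizontal d hd.ne', smul_eq_mul, smul_eq_mul, right, left]
  linear_combination upper_left + lower_left

lemma rectIntegral_comp_sub (f : ℂ → E) (a b c d : ℝ) (p : ℂ) :
    rectIntegral (fun z => f (z - p)) a b c d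
      = rectIntegral f (a - p.re) (b - p.re) (c - p.im) (d - p.im) := by
  have shift : ∀ x y : ℝ,
      (x + y * I - p : ℂ) = ((x - p.re : ℝ) : ℂ) + ((y - p.im : ℝ) : ℂ) * I := by
    intro x y
    apply Complex.ext <;> simp
  simp only [rectIntegral, shift]
  rw [intervalIntegral.integral_comp_sub_right (fun x : ℝ => f (x + (c - p.im : ℝ) * I)),
    intervalIntegral.integral_comp_sub_right (fun x : ℝ => f (x + (d - p.im : ℝ) * I)),
    intervalIntegral.integral_comp_sub_right (fun y : ℝ => f ((b - p.re : ℝ) + y * I)),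
    intervalIntegral.integral_comp_sub_right (fun y : ℝ => f ((a - p.re : ℝ) + y * I))]

lemma rectIntegral_inv_sub {p : ℂ} (hp : p ∈ Ioo a b ×ℂ Ioo c d) :
    rectIntegral (fun z => (z - p)⁻¹) a b c d = 2 * Real.pi * I := by
  rw [rectIntegral_comp_sub (fun z => z⁻¹)]
  exact rectIntegral_inv (sub_neg.2 hp.1.1) (sub_pos.2 hp.1.2) (sub_neg.2 hp.2.1) (sub_pos.2 hp.2.2)

lemma disjoint_rectBoundary : Disjoint (rectBoundary a b c d) (Ioo a b ×ℂ Ioo c d) := by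
  rw [Set.disjoint_left]
  rintro z (⟨-, hz⟩ | ⟨hz, -⟩) ⟨hre, him⟩
  · rcases hz with h | h
    · exact him.1.ne' h
    · exact him.2.ne h
  · rcases hz with h | h
    · exact hre.1.ne' h
    · exact hre.2.ne h

lemma rectBoundary_subset : rectBoundary a b c d ⊆ [[a, b]] ×ℂ [[c, d]] := by
  rintro z (⟨hre, him⟩ | ⟨hre, him⟩)
  · exact ⟨hre, insert_subset left_mem_uIcc (singleton_subset_iff.2 right_mem_uIcc) him⟩
  · exact ⟨insert_subset left_mem_uIcc (singleton_subset_iff.2 right_mem_uIcc) hre, him⟩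

lemma reProdIm_Ioo_mem_nhds {p : ℂ} (hp : p ∈ Ioo a b ×ℂ Ioo c d) :
    [[a, b]] ×ℂ [[c, d]] ∈ nhds p := by
  refine Filter.mem_of_superset ((isOpen_Ioo.reProdIm isOpen_Ioo).mem_nhds hp) ?_
  exact fun z hz => ⟨Icc_subset_uIcc (Ioo_subset_Icc_self hz.1),
    Icc_subset_uIcc (Ioo_subset_Icc_self hz.2)⟩

-- Cauchy's theorem applied to the difference quotient of `f` at `p`.
lemma rectIntegral_inv_sub_mul {f : ℂ → ℂ} {p : ℂ} (hp : p ∈ Ioo a b ×ℂ Ioo c d)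
    (hf : DifferentiableOn ℂ f ([[a, b]] ×ℂ [[c, d]])) :
    rectIntegral (fun z => (z - p)⁻¹ * f z) a b c d = 2 * Real.pi * I * f p := by
  have hne : ∀ z ∈ rectBoundary a b c d, z - p ≠ 0 := fun z hz h =>
    Set.disjoint_left.1 disjoint_rectBoundary hz (sub_eq_zero.1 h ▸ hp)
  have hslope : DifferentiableOn ℂ (dslope f p) ([[a, b]] ×ℂ [[c, d]]) :=
    (differentiableOn_dslope (reProdIm_Ioo_mem_nhds hp)).2 hf
  have hsplit : EqOn (fun z => (z - p)⁻¹ * f z) (fun z => dslope f p z + f p * (z - p)⁻¹)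
      (rectBoundary a b c d) := fun z hz => by
    have := hne z hz
    simp only [dslope_of_ne _ (sub_ne_zero.1 this), slope_def_field]
    field_simp
    ring
  have hinv : ContinuousOn (fun z => (z - p)⁻¹) (rectBoundary a b c d) :=
    ContinuousOn.inv₀ (by fun_prop) hne
  have hconst := rectIntegral_clm_comp (ContinuousLinearMap.mul ℂ ℂ (f p)) hinv
  have hzero : rectIntegral (dslope f p) a b c d = 0 :=
    integral_boundary_rect_eq_zero_of_differentiableOn (dslope f p) ⟨a, c⟩ ⟨b, d⟩ hslope
  rw [rectIntegral_congr hsplit, rectIntegral_add (hslope.continuousOn.mono rectBoundary_subset)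
    (hinv.const_mul (f p)), hzero, zero_add]
  simp only [ContinuousLinearMap.mul_apply', rectIntegral_inv_sub hp] at hconst
  rw [hconst, mul_comm]

end RectangleIntegral

section Resolvent

open Complex Set Interval

lemma mul_resolvent_of_notMem {R A : Type*} [CommSemiring R] [Ring A] [Algebra R A] {a : A} {z : R}
    (hz : z ∉ spectrum R a) : (algebraMap R A z - a) * resolvent a z = 1 :=
  Ring.mul_inverse_cancel _ (spectrum.notMem_iff.1 hz)

lemma resolvent_mul_of_notMem {R A : Type*} [CommSemiring R] [Ring A] [Algebra R A] {a : A} {z : R}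
    (hz : z ∉ spectrum R a) : resolvent a z * (algebraMap R A z - a) = 1 :=
  Ring.inverse_mul_cancel _ (spectrum.notMem_iff.1 hz)

lemma continuousOn_resolvent {𝕜 A : Type*} [NontriviallyNormedField 𝕜] [NormedRing A]
    [NormedAlgebra 𝕜 A] [CompleteSpace A] (a : A) : ContinuousOn (resolvent a) (spectrum 𝕜 a)ᶜ :=
  fun _ hz => (spectrum.hasDerivAt_resolvent_const_left (𝕜 := 𝕜)
    (not_not.1 hz)).continuousAt.continuousWithinAt

variable {A : Type*} [CStarAlgebra A] {a : A}

lemma spectrum_restrict_id {K : Set ℂ} :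
    spectrum ℂ ((ContinuousMap.id ℂ).restrict K) = K := by
  rw [ContinuousMap.spectrum_eq_range]
  ext x
  simp

lemma resolvent_restrict_id_apply {K : Set ℂ} {z : ℂ} (hz : z ∉ K) (x : K) :
    resolvent ((ContinuousMap.id ℂ).restrict K) z x = (z - x)⁻¹ := by
  have h : z ∉ spectrum ℂ ((ContinuousMap.id ℂ).restrict K) := by rwa [spectrum_restrict_id]
  have := congrArg (fun f : C(K, ℂ) => f x) (mul_resolvent_of_notMem h)
  exact eq_inv_of_mul_eq_one_right (by simpa using this)

lemma cfcHom_resolvent (ha : IsStarNormal a) {z : ℂ} (hz : z ∉ spectrum ℂ a) :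
    cfcHom ha (resolvent ((ContinuousMap.id ℂ).restrict (spectrum ℂ a)) z) = resolvent a z := by
  have h : z ∉ spectrum ℂ ((ContinuousMap.id ℂ).restrict (spectrum ℂ a)) := by
    rwa [spectrum_restrict_id]
  have h1 := congrArg (cfcHom ha) (mul_resolvent_of_notMem h)
  rw [map_mul, map_sub, cfcHom_id, map_one, AlgHomClass.commutes] at h1
  rw [← one_mul (cfcHom ha _), ← resolvent_mul_of_notMem hz, mul_assoc, h1, mul_one]

lemma norm_resolvent_le (ha : IsStarNormal a) {z : ℂ} {r : ℝ} (hr : 0 < r)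
    (h : ∀ x ∈ spectrum ℂ a, r ≤ ‖z - x‖) : ‖resolvent a z‖ ≤ r⁻¹ := by
  have hz : z ∉ spectrum ℂ a := fun hz => by simpa using hr.trans_le (h z hz)
  rw [← cfcHom_resolvent ha hz, norm_cfcHom a _ ha, ContinuousMap.norm_le _ (by positivity)]
  intro x
  rw [resolvent_restrict_id_apply hz, norm_inv]
  exact inv_anti₀ hr (h x x.2)

-- By evaluating at each point of the spectrum this reduces to the scalar Cauchy formula.
lemma rectIntegral_smul_resolvent (ha : IsStarNormal a) {x₀ x₁ y₀ y₁ : ℝ} {f : ℂ → ℂ}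
    (hσ : spectrum ℂ a ⊆ Ioo x₀ x₁ ×ℂ Ioo y₀ y₁)
    (hf : DifferentiableOn ℂ f ([[x₀, x₁]] ×ℂ [[y₀, y₁]])) :
    rectIntegral (fun z => f z • resolvent a z) x₀ x₁ y₀ y₁ = (2 * Real.pi * I : ℂ) • cfc f a := by
  set X : C(spectrum ℂ a, ℂ) := (ContinuousMap.id ℂ).restrict (spectrum ℂ a) with hX
  have hout : rectBoundary x₀ x₁ y₀ y₁ ⊆ (spectrum ℂ a)ᶜ :=
    (disjoint_rectBoundary.mono_right hσ).subset_compl_right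
  have hfσ : ContinuousOn f (spectrum ℂ a) := hf.continuousOn.mono fun z hz =>
    mem_of_mem_nhds (reProdIm_Ioo_mem_nhds (hσ hz))
  have hcont : ContinuousOn (fun z => f z • resolvent X z) (rectBoundary x₀ x₁ y₀ y₁) :=
    (hf.continuousOn.mono rectBoundary_subset).smul
      ((continuousOn_resolvent X).mono (by rwa [hX, spectrum_restrict_id]))
  have heval : rectIntegral (fun z => f z • resolvent X z) x₀ x₁ y₀ y₁
      = (2 * Real.pi * I : ℂ) • ⟨_, hfσ.domRestrict⟩ := by
    ext x
    have := rectIntegral_clm_comp (ContinuousMap.evalCLM ℂ x) hcont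
    refine this.symm.trans (Eq.trans (rectIntegral_congr fun z hz => ?_)
      (rectIntegral_inv_sub_mul (hσ x.2) hf))
    simp [hX, resolvent_restrict_id_apply (hout hz), mul_comm]
  have hhom := rectIntegral_clm_comp (cfcL ha) hcont
  rw [heval, map_smul, cfcL_apply, ← cfc_apply f a ha hfσ] at hhom
  refine (rectIntegral_congr fun z hz => ?_).trans hhom
  simp only [map_smul, cfcL_apply, cfcHom_resolvent ha (hout hz), hX]

lemma cfc_cexp_mul (ha : IsStarNormal a) (w : ℂ) :
    cfc (fun z => exp (w * z)) a = NormedSpace.exp (w • a) := by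
  rw [← CFC.exp_eq_normedSpace_exp (𝕜 := ℂ) (by exact (ha.smul w)), exp_eq_exp_ℂ]
  exact cfc_comp_const_mul w NormedSpace.exp a

end Resolvent

section SquareSummable

lemma inner_delta (n : ℤ) (ψ : EllTwo) : inner ℂ (delta n) ψ = ψ n := by
  rw [delta, lp.inner_single_left]
  simp

lemma delta_apply (n m : ℤ) : delta n m = if m = n then 1 else 0 := by
  rw [delta, lp.single_apply, Pi.single_apply]

lemma norm_delta (n : ℤ) : ‖delta n‖ = 1 := by
  rw [delta, lp.norm_single (by norm_num), norm_one]

lemma norm_apply_le (ψ : EllTwo) (n : ℤ) : ‖ψ n‖ ≤ ‖ψ‖ :=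
  lp.norm_apply_le_norm (by norm_num) ψ n

lemma sum_norm_sq_le (ψ : EllTwo) (s : Finset ℤ) : ∑ n ∈ s, ‖ψ n‖ ^ 2 ≤ ‖ψ‖ ^ 2 := by
  simpa using lp.sum_rpow_le_norm_rpow (p := 2) (by norm_num) ψ s

lemma weightedShift_apply (c : ℤ → ℝ) (hc : ∃ C : ℝ, ∀ n, |c n| ≤ C) (k : ℤ) (ψ : EllTwo) (n : ℤ) :
    weightedShift c hc k ψ n = (c n : ℂ) * ψ (n + k) := rfl

lemma norm_weightedShift_le {c : ℤ → ℝ} {C : ℝ} (hC : ∀ n, |c n| ≤ C) (k : ℤ) (ψ : EllTwo) :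
    ‖weightedShift c ⟨C, hC⟩ k ψ‖ ≤ C * ‖ψ‖ :=
  (weightedShift_memlp_and_norm hC k ψ).2

lemma inner_weightedShift (c : ℤ → ℝ) (hc : ∃ C : ℝ, ∀ n, |c n| ≤ C) (k : ℤ) (φ ψ : EllTwo) :
    inner ℂ φ (weightedShift c hc k ψ)
      = inner ℂ (weightedShift (fun n => c (n - k)) (hc.imp fun _ h n => h (n - k)) (-k) φ) ψ := by
  rw [lp.inner_eq_tsum, lp.inner_eq_tsum]
  refine Eq.trans (tsum_congr fun n => ?_) ((Equiv.addRight k).tsum_eq _)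
  simp only [Equiv.coe_addRight, weightedShift_apply, add_sub_cancel_right, add_neg_cancel_right,
    RCLike.inner_apply, map_mul, Complex.conj_ofReal]
  ring

lemma isSelfAdjoint_jacobiOperator (a b : ℤ → ℝ) (ha : ∃ C : ℝ, ∀ n, |a n| ≤ C)
    (hb : ∃ C : ℝ, ∀ n, |b n| ≤ C) : IsSelfAdjoint (jacobiOperator a b ha hb) := by
  rw [ContinuousLinearMap.isSelfAdjoint_iff_isSymmetric]
  intro φ ψ
  simp only [ContinuousLinearMap.coe_coe, jacobiOperator, add_apply,
    inner_add_left, inner_add_right, inner_weightedShift _ _ _ φ, sub_neg_eq_add,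
    add_sub_cancel_right, neg_neg, sub_zero, neg_zero]
  ring

end SquareSummable

section CombesThomas

lemma resolvent_apply_eq_iff {𝕜 E : Type*} [NontriviallyNormedField 𝕜] [NormedAddCommGroup E]
    [NormedSpace 𝕜 E] {H : E →L[𝕜] E} {z : 𝕜} (hz : z ∉ spectrum 𝕜 H) {φ ψ : E} :
    resolvent H z φ = ψ ↔ z • ψ - H ψ = φ := by
  constructor
  · rintro rfl
    simpa [Algebra.algebraMap_eq_smul_one] using congr($(mul_resolvent_of_notMem hz) φ)
  · rintro rfl
    simpa [Algebra.algebraMap_eq_smul_one] using congr($(resolvent_mul_of_notMem hz) ψ)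

lemma abs_one_sub_exp_le {η x : ℝ} (h : |x| ≤ η) : |1 - Real.exp x| ≤ Real.exp η - 1 := by
  have upper : Real.exp x ≤ Real.exp η := Real.exp_le_exp.2 (abs_le.1 h).2
  have lower : Real.exp (-η) ≤ Real.exp x := Real.exp_le_exp.2 (abs_le.1 h).1
  have symm : 2 ≤ Real.exp η + Real.exp (-η) := by
    linarith [Real.one_le_cosh η, Real.cosh_eq η]
  rw [abs_le]
  constructor <;> linarith

/-- Multiplication by `e^w` on `ℓ²(ℤ)`, for a real weight `w` bounded above; conjugation by it turns
norm bounds into exponential decay. -/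
def expWeight (w : ℤ → ℝ) (hw : ∃ C : ℝ, ∀ n, w n ≤ C) : EllTwo →L[ℂ] EllTwo :=
  weightedShift (fun n => Real.exp (w n))
    (hw.imp' Real.exp fun _ h n => by simpa using h n) 0

lemma expWeight_apply (w : ℤ → ℝ) (hw : ∃ C : ℝ, ∀ n, w n ≤ C) (ψ : EllTwo) (n : ℤ) :
    expWeight w hw ψ n = Real.exp (w n) * ψ n := by
  rw [expWeight, weightedShift_apply, add_zero]

lemma expWeight_delta (w : ℤ → ℝ) (hw : ∃ C : ℝ, ∀ n, w n ≤ C) (m : ℤ) :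
    expWeight w hw (delta m) = (Real.exp (w m) : ℂ) • delta m := by
  ext n
  rw [expWeight_apply, lp.coeFn_smul, Pi.smul_apply, smul_eq_mul, delta_apply]
  split_ifs with h
  · rw [h]
  · rw [mul_zero, mul_zero]

variable {w : ℤ → ℝ} {η Λ : ℝ}

lemma norm_weightedShift_expWeight_sub_le (hw : ∃ C : ℝ, ∀ n, w n ≤ C) {c : ℤ → ℝ} {C : ℝ}
    (hc : ∀ n, |c n| ≤ C) {k : ℤ} (hη : ∀ n, |w n - w (n + k)| ≤ η) (ψ : EllTwo) :
    ‖weightedShift c ⟨C, hc⟩ k (expWeight w hw ψ) - expWeight w hw (weightedShift c ⟨C, hc⟩ k ψ)‖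
      ≤ C * (Real.exp η - 1) * ‖expWeight w hw ψ‖ := by
  have hbound : ∀ n, |c n * (1 - Real.exp (w n - w (n + k)))| ≤ C * (Real.exp η - 1) := fun n => by
    rw [abs_mul]
    exact mul_le_mul (hc n) (abs_one_sub_exp_le (hη n)) (abs_nonneg _) ((abs_nonneg _).trans (hc n))
  refine le_of_eq_of_le (congrArg norm ?_) (norm_weightedShift_le hbound k (expWeight w hw ψ))
  ext n
  have hexp : (Real.exp (w n - w (n + k)) * Real.exp (w (n + k)) : ℂ) = Real.exp (w n) := by
    rw [← Complex.ofReal_mul, ← Real.exp_add, sub_add_cancel]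
  rw [lp.coeFn_sub, Pi.sub_apply, weightedShift_apply, weightedShift_apply, expWeight_apply,
    expWeight_apply, weightedShift_apply, Complex.ofReal_mul, Complex.ofReal_sub,
    Complex.ofReal_one]
  linear_combination ((c n : ℂ) * ψ (n + k)) * hexp

lemma norm_jacobiOperator_expWeight_sub_le (hw : ∃ C : ℝ, ∀ n, w n ≤ C)
    (hη : ∀ n, |w n - w (n + 1)| ≤ η) {a b : ℤ → ℝ} (ha : ∀ n, |a n| ≤ Λ)
    (hb : ∃ C : ℝ, ∀ n, |b n| ≤ C) (ψ : EllTwo) :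
    ‖jacobiOperator a b ⟨Λ, ha⟩ hb (expWeight w hw ψ)
        - expWeight w hw (jacobiOperator a b ⟨Λ, ha⟩ hb ψ)‖
      ≤ 2 * Λ * (Real.exp η - 1) * ‖expWeight w hw ψ‖ := by
  obtain ⟨C, hC⟩ := hb
  have hη' : ∀ n, |w n - w (n + -1)| ≤ η := fun n => by
    rw [abs_sub_comm]
    simpa [← sub_eq_add_neg] using hη (n - 1)
  have right := norm_weightedShift_expWeight_sub_le hw ha hη ψ
  have left := norm_weightedShift_expWeight_sub_le hw (fun n => ha (n - 1)) hη' ψ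
  have diagonal := norm_weightedShift_expWeight_sub_le (k := 0) (η := 0) hw hC (by simp) ψ
  rw [Real.exp_zero, sub_self, mul_zero, zero_mul] at diagonal
  simp only [jacobiOperator, add_apply, map_add, add_sub_add_comm]
  refine (norm_add₃_le).trans ((add_le_add_three right left diagonal).trans_eq ?_)
  ring

lemma norm_expWeight_resolvent_le (hw : ∃ C : ℝ, ∀ n, w n ≤ C)
    (hη : ∀ n, |w n - w (n + 1)| ≤ η) {a b : ℤ → ℝ} (ha : ∀ n, |a n| ≤ Λ)
    (hb : ∃ C : ℝ, ∀ n, |b n| ≤ C) {z : ℂ}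
    (hz : z ∉ spectrum ℂ (jacobiOperator a b ⟨Λ, ha⟩ hb))
    (hR : 2 * Λ * (Real.exp η - 1) * ‖resolvent (jacobiOperator a b ⟨Λ, ha⟩ hb) z‖ ≤ 1 / 2)
    (φ : EllTwo) :
    ‖expWeight w hw (resolvent (jacobiOperator a b ⟨Λ, ha⟩ hb) z φ)‖
      ≤ 2 * ‖resolvent (jacobiOperator a b ⟨Λ, ha⟩ hb) z‖ * ‖expWeight w hw φ‖ := by
  set J := jacobiOperator a b ⟨Λ, ha⟩ hb
  set D := expWeight w hw
  set ψ := resolvent J z φ with hψ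
  have hφ : z • ψ - J ψ = φ := (resolvent_apply_eq_iff hz).1 hψ.symm
  have hDψ : resolvent J z (D φ - (J (D ψ) - D (J ψ))) = D ψ := by
    rw [resolvent_apply_eq_iff hz, ← hφ, map_sub, map_smul]
    abel
  have hcomm : ‖J (D ψ) - D (J ψ)‖ ≤ 2 * Λ * (Real.exp η - 1) * ‖D ψ‖ :=
    norm_jacobiOperator_expWeight_sub_le hw hη ha hb ψ
  have habsorb : ‖D ψ‖ ≤ ‖resolvent J z‖ * ‖D φ‖ + 1 / 2 * ‖D ψ‖ := by
    calc ‖D ψ‖ ≤ ‖resolvent J z‖ * ‖D φ - (J (D ψ) - D (J ψ))‖ := by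
          conv_lhs => rw [← hDψ]
          exact (resolvent J z).le_opNorm _
      _ ≤ ‖resolvent J z‖ * (‖D φ‖ + 2 * Λ * (Real.exp η - 1) * ‖D ψ‖) := by
          gcongr
          exact (norm_sub_le _ _).trans (by gcongr)
      _ = ‖resolvent J z‖ * ‖D φ‖
            + 2 * Λ * (Real.exp η - 1) * ‖resolvent J z‖ * ‖D ψ‖ := by ring
      _ ≤ ‖resolvent J z‖ * ‖D φ‖ + 1 / 2 * ‖D ψ‖ := by gcongr
  linarith

-- The Combes–Thomas estimate. The weight `η |j - m|` is cut off at its value in `n` to stay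
-- bounded.
lemma norm_resolvent_jacobiOperator_delta_apply_le {a b : ℤ → ℝ} (ha : ∀ n, |a n| ≤ Λ)
    (hb : ∃ C : ℝ, ∀ n, |b n| ≤ C) (hη : 0 ≤ η) {z : ℂ}
    (hz : z ∉ spectrum ℂ (jacobiOperator a b ⟨Λ, ha⟩ hb))
    (hR : 2 * Λ * (Real.exp η - 1) * ‖resolvent (jacobiOperator a b ⟨Λ, ha⟩ hb) z‖ ≤ 1 / 2)
    (m n : ℤ) :
    ‖resolvent (jacobiOperator a b ⟨Λ, ha⟩ hb) z (delta m) n‖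
      ≤ 2 * ‖resolvent (jacobiOperator a b ⟨Λ, ha⟩ hb) z‖ * Real.exp (-(η * |(n : ℝ) - m|)) := by
  let w : ℤ → ℝ := fun j => η * min |(j : ℝ) - m| |(n : ℝ) - m|
  have hw : ∃ C : ℝ, ∀ j, w j ≤ C :=
    ⟨η * |(n : ℝ) - m|, fun j => mul_le_mul_of_nonneg_left (min_le_right _ _) hη⟩
  have hlip : ∀ j, |w j - w (j + 1)| ≤ η := fun j => by
    rw [← mul_sub, abs_mul, abs_of_nonneg hη]
    refine mul_le_of_le_one_right hη ((abs_min_sub_min_le_max _ _ _ _).trans ?_)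
    rw [sub_self, abs_zero]
    refine max_le ((abs_abs_sub_abs_le _ _).trans_eq ?_) zero_le_one
    push_cast
    rw [sub_sub_sub_cancel_right, sub_add_cancel_left, abs_neg, abs_one]
  have hwm : w m = 0 := by simp [w]
  have hwn : w n = η * |(n : ℝ) - m| := by simp only [w, min_self]
  have hbound := (norm_apply_le _ n).trans
    (norm_expWeight_resolvent_le hw hlip ha hb hz hR (delta m))
  rw [expWeight_delta, hwm, Real.exp_zero, Complex.ofReal_one, one_smul, norm_delta, mul_one,
    expWeight_apply, hwn, norm_mul, Complex.norm_real, Real.norm_of_nonneg (Real.exp_pos _).le]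
    at hbound
  rw [Real.exp_neg, ← div_eq_mul_inv, le_div_iff₀ (Real.exp_pos _), mul_comm]
  exact hbound

end CombesThomas

section TransferMatrix

open Matrix

lemma l2_opNorm_sq_le_sum_norm_sq {𝕜 m n : Type*} [RCLike 𝕜] [Fintype m] [Fintype n]
    [DecidableEq n] (A : Matrix m n 𝕜) : ‖A‖ ^ 2 ≤ ∑ i, ∑ j, ‖A i j‖ ^ 2 := by
  have hA : 0 ≤ ∑ i, ∑ j, ‖A i j‖ ^ 2 := by positivity
  rw [← Real.le_sqrt (norm_nonneg _) hA, l2_opNorm_def]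
  refine ContinuousLinearMap.opNorm_le_bound _ (Real.sqrt_nonneg _) fun x => ?_
  rw [EuclideanSpace.norm_eq, EuclideanSpace.norm_eq x, ← Real.sqrt_mul hA, Finset.sum_mul]
  refine Real.sqrt_le_sqrt (Finset.sum_le_sum fun i _ => ?_)
  calc ‖∑ j, A i j * x j‖ ^ 2 ≤ (∑ j, ‖A i j‖ * ‖x j‖) ^ 2 := by
        gcongr
        exact (norm_sum_le _ _).trans_eq (by simp only [norm_mul])
    _ ≤ (∑ j, ‖A i j‖ ^ 2) * ∑ j, ‖x j‖ ^ 2 := Finset.sum_mul_sq_le_sq_mul_sq _ _ _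

lemma stepMatrix_eq {a : ℤ → ℝ} {n : ℤ} (ha : a n ≠ 0) (z : ℂ) :
    stepMatrix a n z = !![(a n : ℂ)⁻¹ * z, -(a n : ℂ)⁻¹; (a n : ℂ), 0] := by
  have : (a n : ℂ) ≠ 0 := Complex.ofReal_ne_zero.2 ha
  simp only [stepMatrix, smul_of, smul_cons, smul_eq_mul, smul_empty, mul_neg, mul_one, mul_zero,
    pow_two, inv_mul_cancel_left₀ this]

lemma stepMatrix_mulVec {a : ℤ → ℝ} {n : ℤ} (ha : a n ≠ 0) (z x y : ℂ) :
    stepMatrix a n z *ᵥ ![x, y] = ![(a n : ℂ)⁻¹ * (z * x - y), a n * x] := by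
  rw [stepMatrix_eq ha]
  ext i
  fin_cases i
  · simp only [Fin.zero_eta, Fin.isValue, mulVec_cons, Nat.succ_eq_add_one, Nat.reduceAdd,
      mulVec_empty, add_zero, Pi.add_apply, Pi.smul_apply, Function.comp_apply, cons_val_zero,
      head_cons, smul_eq_mul, tail_cons, mul_neg]
    ring
  · simp [mul_comm]

lemma det_stepMatrix {a : ℤ → ℝ} {n : ℤ} (ha : a n ≠ 0) (z : ℂ) : (stepMatrix a n z).det = 1 := by
  have : (a n : ℂ) ≠ 0 := Complex.ofReal_ne_zero.2 ha
  rw [stepMatrix_eq ha, det_fin_two_of, mul_zero, zero_sub, neg_mul, neg_neg, inv_mul_cancel₀ this]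

lemma transferMatrix_succ (a : ℤ → ℝ) (n : ℕ) (z : ℂ) :
    transferMatrix a (n + 1) z = stepMatrix a ((n : ℤ) + 1) z * transferMatrix a n z := rfl

lemma transferMatrix_congr {a a' : ℤ → ℝ} (h : ∀ n : ℤ, 1 ≤ n → a n = a' n) (n : ℕ) (z : ℂ) :
    transferMatrix a n z = transferMatrix a' n z := by
  induction n with
  | zero => rfl
  | succ n ih =>
    rw [transferMatrix_succ, transferMatrix_succ, ih, stepMatrix, stepMatrix, h _ (by lia)]

lemma continuous_transferMatrix (a : ℤ → ℝ) (n : ℕ) : Continuous (transferMatrix a n) := by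
  induction n with
  | zero => exact continuous_const
  | succ n ih =>
    refine Continuous.mul (continuous_matrix fun i j => ?_) ih
    fin_cases i <;> fin_cases j <;> simp only [stepMatrix, Matrix.smul_apply] <;> fun_prop

variable {a : ℤ → ℝ}

lemma det_transferMatrix (ha : ∀ n, a n ≠ 0) (n : ℕ) (z : ℂ) : (transferMatrix a n z).det = 1 := by
  induction n with
  | zero => exact det_one
  | succ n ih => rw [transferMatrix_succ, det_mul, ih, det_stepMatrix (ha _), mul_one]

lemma transferMatrix_succ_one_apply (ha : ∀ n, a n ≠ 0) (n : ℕ) (z : ℂ) (j : Fin 2) :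
    transferMatrix a (n + 1) z 1 j = a (n + 1) * transferMatrix a n z 0 j := by
  rw [transferMatrix_succ, mul_apply, Fin.sum_univ_two, stepMatrix_eq (ha _)]
  simp

lemma transferMatrix_mulVec (ha : ∀ n, a n ≠ 0) {z : ℂ} {x y : ℕ → ℂ} {k : ℕ}
    (hx : ∀ n < k, a (n + 1) * x (n + 1) + y n = z * x n)
    (hy : ∀ n < k, y (n + 1) = a (n + 1) * x n) :
    transferMatrix a k z *ᵥ ![x 0, y 0] = ![x k, y k] := by
  induction k with
  | zero => exact one_mulVec _
  | succ n ih =>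
    have hne : (a (n + 1) : ℂ) ≠ 0 := Complex.ofReal_ne_zero.2 (ha _)
    have hstep : (a (n + 1) : ℂ)⁻¹ * (z * x n - y n) = x (n + 1) := by
      rw [← hx n n.lt_succ_self]
      field_simp
      ring
    rw [transferMatrix_succ, ← mulVec_mulVec, ih (fun m hm => hx m (by lia))
      (fun m hm => hy m (by lia)), stepMatrix_mulVec (ha _), hstep, hy n n.lt_succ_self]

lemma norm_sq_row_zero_mul_of_mulVec_eq {A : Matrix (Fin 2) (Fin 2) ℂ} (hA : A.det = 1)
    {x y w : ℂ} (h : A *ᵥ ![x, y] = ![0, w]) :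
    (‖A 0 0‖ ^ 2 + ‖A 0 1‖ ^ 2) * ‖w‖ ^ 2 = ‖x‖ ^ 2 + ‖y‖ ^ 2 := by
  have h0 : A 0 0 * x + A 0 1 * y = 0 := by
    simpa [mulVec, dotProduct, Fin.sum_univ_two] using congrFun h 0
  have h1 : A 1 0 * x + A 1 1 * y = w := by
    simpa [mulVec, dotProduct, Fin.sum_univ_two] using congrFun h 1
  rw [det_fin_two] at hA
  have hx : x = -(A 0 1 * w) := by linear_combination (-x) * hA + A 1 1 * h0 - A 0 1 * h1
  have hy : y = A 0 0 * w := by linear_combination (-y) * hA + A 0 0 * h1 - A 1 0 * h0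
  rw [hx, hy, norm_neg, norm_mul, norm_mul]
  ring

lemma norm_sq_transferMatrix_succ_le (ha : ∀ n, a n ≠ 0) (n : ℕ) (z : ℂ) :
    ‖transferMatrix a (n + 1) z‖ ^ 2
      ≤ (‖transferMatrix a (n + 1) z 0 0‖ ^ 2 + ‖transferMatrix a (n + 1) z 0 1‖ ^ 2)
        + a (n + 1) ^ 2 * (‖transferMatrix a n z 0 0‖ ^ 2 + ‖transferMatrix a n z 0 1‖ ^ 2) := by
  refine (l2_opNorm_sq_le_sum_norm_sq _).trans_eq ?_
  simp only [Fin.sum_univ_two, transferMatrix_succ_one_apply ha, norm_mul, mul_pow,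
    Complex.norm_real, Real.norm_eq_abs, sq_abs]
  ring

lemma continuous_maxTransferNormSq (a : ℤ → ℝ) (N : ℕ) (hN : 1 ≤ N) :
    Continuous (maxTransferNormSq a N hN) :=
  Continuous.finset_sup'_apply _ fun n _ => (continuous_transferMatrix a n).norm.pow 2

lemma maxTransferNormSq_pos (ha : ∀ n, a n ≠ 0) (N : ℕ) (hN : 1 ≤ N) (z : ℂ) :
    0 < maxTransferNormSq a N hN z := by
  refine lt_of_lt_of_le ?_ (Finset.le_sup' (fun n => ‖transferMatrix a n z‖ ^ 2)
    (Finset.mem_Icc.2 ⟨le_rfl, hN⟩))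
  have : transferMatrix a 1 z ≠ 0 := fun h => by
    simpa [h] using det_transferMatrix ha 1 z
  positivity

end TransferMatrix

section Decoupling

lemma norm_resolvent_le_of_im_ne_zero {A : Type*} [CStarAlgebra A] {a : A} (ha : IsSelfAdjoint a)
    {z : ℂ} (hz : z.im ≠ 0) : ‖resolvent a z‖ ≤ |z.im|⁻¹ := by
  refine norm_resolvent_le ha.isStarNormal (abs_pos.2 hz) fun x hx => ?_
  simpa [ha.im_eq_zero_of_mem_spectrum hx] using Complex.abs_im_le_norm (z - x)

lemma notMem_spectrum_of_im_ne_zero {A : Type*} [CStarAlgebra A] {a : A} (ha : IsSelfAdjoint a)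
    {z : ℂ} (hz : z.im ≠ 0) : z ∉ spectrum ℂ a :=
  fun h => hz (ha.im_eq_zero_of_mem_spectrum h)

lemma norm_resolvent_delta_le {H : EllTwo →L[ℂ] EllTwo} (hH : IsSelfAdjoint H) {z : ℂ}
    (hz : z.im ≠ 0) (n : ℤ) : ‖resolvent H z (delta n)‖ ≤ |z.im|⁻¹ := by
  have h := (resolvent H z).le_opNorm (delta n)
  rw [norm_delta, mul_one] at h
  exact h.trans (norm_resolvent_le_of_im_ne_zero hH hz)

lemma resolvent_apply_of_intertwines {𝕜 E F : Type*} [NontriviallyNormedField 𝕜]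
    [NormedAddCommGroup E] [NormedSpace 𝕜 E] [NormedAddCommGroup F] [NormedSpace 𝕜 F]
    {H : E →L[𝕜] E} {H' : F →L[𝕜] F} {T : E →ₗ[𝕜] F} (hT : ∀ ψ, T (H ψ) = H' (T ψ)) {z : 𝕜}
    (hz : z ∉ spectrum 𝕜 H) (hz' : z ∉ spectrum 𝕜 H') (φ : E) :
    resolvent H' z (T φ) = T (resolvent H z φ) := by
  rw [resolvent_apply_eq_iff hz', ← map_smul, ← hT, ← map_sub, (resolvent_apply_eq_iff hz).1 rfl]

/-- The Jacobi operator with hopping sequence `a` and vanishing diagonal. -/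
def hoppingOperator (a : ℤ → ℝ) (ha : ∃ C : ℝ, ∀ n, |a n| ≤ C) : EllTwo →L[ℂ] EllTwo :=
  jacobiOperator a (fun _ => 0) ha ⟨0, fun _ => by simp⟩

lemma hoppingOperator_apply (a : ℤ → ℝ) (ha : ∃ C : ℝ, ∀ n, |a n| ≤ C) (ψ : EllTwo) (n : ℤ) :
    hoppingOperator a ha ψ n = (a n : ℂ) * ψ (n + 1) + (a (n - 1) : ℂ) * ψ (n - 1) := by
  rw [hoppingOperator, jacobiOperator_apply, Complex.ofReal_zero, zero_mul, add_zero]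

lemma isSelfAdjoint_hoppingOperator (a : ℤ → ℝ) (ha : ∃ C : ℝ, ∀ n, |a n| ≤ C) :
    IsSelfAdjoint (hoppingOperator a ha) := isSelfAdjoint_jacobiOperator _ _ _ _

lemma notMem_spectrum_hoppingOperator (a : ℤ → ℝ) (ha : ∃ C : ℝ, ∀ n, |a n| ≤ C) {z : ℂ}
    (hz : z.im ≠ 0) : z ∉ spectrum ℂ (hoppingOperator a ha) :=
  notMem_spectrum_of_im_ne_zero (isSelfAdjoint_hoppingOperator a ha) hz

lemma resolvent_hoppingOperator_recurrence {a : ℤ → ℝ} {ha : ∃ C : ℝ, ∀ n, |a n| ≤ C} {z : ℂ}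
    (hz : z ∉ spectrum ℂ (hoppingOperator a ha)) (φ : EllTwo) (n : ℤ) :
    z * resolvent (hoppingOperator a ha) z φ n
      - (a n * resolvent (hoppingOperator a ha) z φ (n + 1)
        + a (n - 1) * resolvent (hoppingOperator a ha) z φ (n - 1)) = φ n := by
  rw [← hoppingOperator_apply a ha]
  exact congr($((resolvent_apply_eq_iff hz (φ := φ)).1 rfl) n)

/-- The hopping sequence `a` with the bond between the sites `k` and `k + 1` removed, which
decouples the half-lines `n ≤ k` and `n > k`. -/
def cutBond (a : ℤ → ℝ) (k : ℤ) : ℤ → ℝ := Function.update a k 0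

lemma cutBond_self (a : ℤ → ℝ) (k : ℤ) : cutBond a k k = 0 := Function.update_self ..

lemma cutBond_of_ne (a : ℤ → ℝ) {k n : ℤ} (h : n ≠ k) : cutBond a k n = a n :=
  Function.update_of_ne h ..

variable {a : ℤ → ℝ}

lemma cutBond_bounded (ha : ∃ C : ℝ, ∀ n, |a n| ≤ C) (k : ℤ) :
    ∃ C : ℝ, ∀ n, |cutBond a k n| ≤ C := by
  refine ha.imp fun C h n => ?_
  rcases eq_or_ne n k with rfl | hn
  · simpa only [cutBond_self, abs_zero] using (abs_nonneg _).trans (h n)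
  · simpa only [cutBond_of_ne a hn] using h n

/-- The orthogonal projection of `ℓ²(ℤ)` onto the sequences supported on the sites `n > k`. -/
def rightProjection (k : ℤ) : EllTwo →L[ℂ] EllTwo :=
  weightedShift (fun n => if k < n then 1 else 0) ⟨1, fun n => by split_ifs <;> simp⟩ 0

lemma rightProjection_apply (k : ℤ) (ψ : EllTwo) (n : ℤ) :
    rightProjection k ψ n = if k < n then ψ n else 0 := by
  rw [rightProjection, weightedShift_apply, add_zero]
  split_ifs <;> simp

lemma rightProjection_delta_of_le {s k : ℤ} (h : s ≤ k) : rightProjection k (delta s) = 0 := by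
  ext n
  rw [rightProjection_apply, delta_apply, lp.coeFn_zero, Pi.zero_apply]
  split_ifs <;> first | rfl | lia

lemma rightProjection_hoppingOperator_cutBond (ha : ∃ C : ℝ, ∀ n, |a n| ≤ C) (k : ℤ) (ψ : EllTwo) :
    rightProjection k (hoppingOperator (cutBond a k) (cutBond_bounded ha k) ψ)
      = hoppingOperator (cutBond a k) (cutBond_bounded ha k) (rightProjection k ψ) := by
  ext n
  simp only [rightProjection_apply, hoppingOperator_apply]
  rcases lt_trichotomy n k with h | rfl | h
  · rw [if_neg (by lia), if_neg (by lia), if_neg (by lia)]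
    simp
  · simp [cutBond_self]
  · rcases eq_or_ne n (k + 1) with rfl | h'
    · simp [cutBond_self, h, h.trans (lt_add_one _)]
    · rw [if_pos h, if_pos (by lia), if_pos (by lia)]

lemma resolvent_cutBond_delta_apply_eq_zero (ha : ∃ C : ℝ, ∀ n, |a n| ≤ C) {z : ℂ}
    (hz : z.im ≠ 0) {s k n : ℤ} (hsk : s ≤ k) (hn : k < n) :
    resolvent (hoppingOperator (cutBond a k) (cutBond_bounded ha k)) z (delta s) n = 0 := by
  have hσ := notMem_spectrum_hoppingOperator _ (cutBond_bounded ha k) hz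
  have h := resolvent_apply_of_intertwines (T := (rightProjection k).toLinearMap)
    (rightProjection_hoppingOperator_cutBond ha k) hσ hσ (delta s)
  simp only [ContinuousLinearMap.coe_coe, rightProjection_delta_of_le hsk, map_zero] at h
  simpa [rightProjection_apply, hn] using congr($h.symm n)

lemma hoppingOperator_eq_cutBond_add (ha : ∃ C : ℝ, ∀ n, |a n| ≤ C) (k : ℤ) (ψ : EllTwo) :
    hoppingOperator a ha ψ = hoppingOperator (cutBond a k) (cutBond_bounded ha k) ψ
      + ((a k * ψ (k + 1)) • delta k + (a k * ψ k) • delta (k + 1)) := by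
  ext n
  simp only [lp.coeFn_add, lp.coeFn_smul, Pi.add_apply, Pi.smul_apply, smul_eq_mul,
    hoppingOperator_apply, delta_apply]
  rcases eq_or_ne n k with rfl | hk
  · simp only [cutBond_self, cutBond_of_ne, Complex.ofReal_zero, zero_mul, ne_eq, sub_eq_self,
      one_ne_zero, not_false_eq_true, zero_add, ↓reduceIte, mul_one, left_eq_add, mul_zero,
      add_zero]
    ring
  · rcases eq_or_ne n (k + 1) with rfl | hk'
    · simp [cutBond_self, cutBond_of_ne]
    · rw [cutBond_of_ne a hk, cutBond_of_ne a (by lia), if_neg hk, if_neg hk']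
      ring

-- The resolvent identity for the rank-two perturbation that removes the bond `(k, k + 1)`; one of
-- its two terms vanishes because the decoupled resolvent does not reach the site `k + 1`.
lemma resolvent_delta_eq_cutBond_add (ha : ∃ C : ℝ, ∀ n, |a n| ≤ C) {z : ℂ} (hz : z.im ≠ 0)
    {s k : ℤ} (hsk : s ≤ k) :
    resolvent (hoppingOperator a ha) z (delta s)
      = resolvent (hoppingOperator (cutBond a k) (cutBond_bounded ha k)) z (delta s)
        + (a k * resolvent (hoppingOperator (cutBond a k) (cutBond_bounded ha k)) z (delta s) k)
          • resolvent (hoppingOperator a ha) z (delta (k + 1)) := by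
  have hσ := notMem_spectrum_hoppingOperator a ha hz
  set v := resolvent (hoppingOperator (cutBond a k) (cutBond_bounded ha k)) z (delta s) with hv
  set r := resolvent (hoppingOperator a ha) z (delta (k + 1)) with hr
  have hvk : v (k + 1) = 0 := resolvent_cutBond_delta_apply_eq_zero ha hz hsk (lt_add_one k)
  have hv' := (resolvent_apply_eq_iff
    (notMem_spectrum_hoppingOperator _ (cutBond_bounded ha k) hz)).1 hv.symm
  have hr' := (resolvent_apply_eq_iff hσ).1 hr.symm
  rw [resolvent_apply_eq_iff hσ, map_add, map_smul, hoppingOperator_eq_cutBond_add ha k v, hvk]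
  refine Eq.trans ?_ hv'
  rw [← hr']
  module

lemma resolvent_delta_apply_eq_cutBond_mul (ha : ∃ C : ℝ, ∀ n, |a n| ≤ C) {z : ℂ} (hz : z.im ≠ 0)
    {s k n : ℤ} (hsk : s ≤ k) (hn : k < n) :
    resolvent (hoppingOperator a ha) z (delta s) n
      = a k * resolvent (hoppingOperator (cutBond a k) (cutBond_bounded ha k)) z (delta s) k
        * resolvent (hoppingOperator a ha) z (delta (k + 1)) n := by
  rw [resolvent_delta_eq_cutBond_add ha hz hsk, lp.coeFn_add, Pi.add_apply,
    resolvent_cutBond_delta_apply_eq_zero ha hz hsk hn, zero_add]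
  rfl

end Decoupling

section HalfLine

open Matrix

variable {a : ℤ → ℝ} {z : ℂ} {s : ℤ}

lemma transferMatrix_mulVec_resolvent_cutBond (ha : ∃ C : ℝ, ∀ n, |a n| ≤ C)
    (ha₀ : ∀ n, a n ≠ 0) (hz : z.im ≠ 0) (hs : s ≤ 1) {k : ℕ} (hk : 1 ≤ k) {v : EllTwo}
    (hv : resolvent (hoppingOperator (cutBond a k) (cutBond_bounded ha k)) z (delta s) = v) :
    transferMatrix a k z *ᵥ ![v 1, a 0 * v 0 + delta s 1] = ![0, a k * v k] := by
  have hzero (n : ℤ) (hn : k < n) : v n = 0 :=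
    hv ▸ resolvent_cutBond_delta_apply_eq_zero ha hz (by lia) hn
  have hcut (n : ℤ) (hn : n ≤ k) : (cutBond a k n : ℂ) * v (n + 1) = a n * v (n + 1) := by
    rcases eq_or_ne n k with rfl | hne
    · rw [hzero _ (lt_add_one _), mul_zero, mul_zero]
    · rw [cutBond_of_ne a hne]
  have hrec (n : ℕ) (hn : n < k) :
      z * v (n + 1) - (a (n + 1) * v (n + 1 + 1) + a n * v n) = delta s (n + 1) := by
    rw [← hcut _ (by lia), ← cutBond_of_ne a (show (n : ℤ) ≠ k by lia), ← hv]
    simpa only [add_sub_cancel_right] using resolvent_hoppingOperator_recurrence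
      (notMem_spectrum_hoppingOperator _ (cutBond_bounded ha k) hz) (delta s) (n + 1)
  have h := transferMatrix_mulVec ha₀ (z := z) (k := k) (x := fun n => v (n + 1))
    (y := fun n => a n * v n + if n = 0 then delta s 1 else 0)
    (fun n hn => by
      have hδ : (if n = 0 then delta s 1 else 0) = delta s (n + 1) := by
        split_ifs with h0
        · rw [h0, Nat.cast_zero, zero_add]
        · rw [delta_apply, if_neg (by lia)]
      rw [hδ, ← hrec n hn]
      push_cast
      ring)
    (fun n _ => by simp)
  simpa [hzero _ (lt_add_one _), Nat.ne_of_gt hk] using h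

lemma sum_norm_sq_resolvent_delta_le {H : EllTwo →L[ℂ] EllTwo} (hH : IsSelfAdjoint H)
    (hz : z.im ≠ 0) (s : ℤ) (F : Finset ℤ) :
    ∑ n ∈ F, ‖resolvent H z (delta s) n‖ ^ 2 ≤ |z.im|⁻¹ ^ 2 := by
  refine (sum_norm_sq_le _ F).trans ?_
  gcongr
  exact norm_resolvent_delta_le hH hz s

variable {Λ : ℝ} (ha : ∀ n, |a n| ≤ Λ) (ha₀ : ∀ n, a n ≠ 0) (hz : z.im ≠ 0) (hz₁ : |z.im| ≤ 1)
include ha ha₀ hz hz₁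

lemma norm_sq_row_zero_transferMatrix_mul_cutBond_le (hs : s ≤ 1) {k : ℕ} (hk : 1 ≤ k) :
    (‖transferMatrix a k z 0 0‖ ^ 2 + ‖transferMatrix a k z 0 1‖ ^ 2)
        * ‖a k * resolvent (hoppingOperator (cutBond a k) (cutBond_bounded ⟨Λ, ha⟩ k)) z
            (delta s) k‖ ^ 2
      ≤ 2 * (Λ + 1) ^ 2 * |z.im|⁻¹ ^ 2 := by
  have hΛ : 0 ≤ Λ := (abs_nonneg _).trans (ha 0)
  have hρ : 1 ≤ |z.im|⁻¹ := (one_le_inv₀ (abs_pos.2 hz)).2 hz₁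
  obtain ⟨v, hv⟩ : ∃ v, resolvent (hoppingOperator (cutBond a k)
    (cutBond_bounded ⟨Λ, ha⟩ k)) z (delta s) = v := ⟨_, rfl⟩
  have hvn (n : ℤ) : ‖v n‖ ≤ |z.im|⁻¹ := hv ▸ (norm_apply_le _ n).trans
    (norm_resolvent_delta_le (isSelfAdjoint_hoppingOperator _ _) hz s)
  have hx : ‖v 1‖ ≤ (Λ + 1) * |z.im|⁻¹ := (hvn 1).trans (le_mul_of_one_le_left (by positivity)
    (le_add_of_nonneg_left hΛ))
  have hy : ‖a 0 * v 0 + delta s 1‖ ≤ (Λ + 1) * |z.im|⁻¹ := by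
    rw [add_one_mul]
    refine norm_add_le_of_le ?_ (((norm_apply_le _ _).trans_eq (norm_delta s)).trans hρ)
    rw [norm_mul, Complex.norm_real, Real.norm_eq_abs]
    exact mul_le_mul (ha 0) (hvn 0) (norm_nonneg _) hΛ
  rw [hv, norm_sq_row_zero_mul_of_mulVec_eq (det_transferMatrix ha₀ k z)
    (transferMatrix_mulVec_resolvent_cutBond ⟨Λ, ha⟩ ha₀ hz hs hk hv)]
  calc _ ≤ ((Λ + 1) * |z.im|⁻¹) ^ 2 + ((Λ + 1) * |z.im|⁻¹) ^ 2 := by gcongr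
    _ = 2 * (Λ + 1) ^ 2 * |z.im|⁻¹ ^ 2 := by ring

lemma norm_sq_row_zero_transferMatrix_mul_sum_le (hs : s ≤ 1) (k : ℕ) {F : Finset ℤ}
    (hF : ∀ n ∈ F, (k : ℤ) < n) :
    (‖transferMatrix a k z 0 0‖ ^ 2 + ‖transferMatrix a k z 0 1‖ ^ 2)
        * ∑ n ∈ F, ‖resolvent (hoppingOperator a ⟨Λ, ha⟩) z (delta s) n‖ ^ 2
      ≤ 2 * (Λ + 1) ^ 2 * |z.im|⁻¹ ^ 4 := by
  have hΛ : 0 ≤ Λ := (abs_nonneg _).trans (ha 0)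
  have hρ : 1 ≤ |z.im|⁻¹ := (one_le_inv₀ (abs_pos.2 hz)).2 hz₁
  have hsum (m : ℤ) := sum_norm_sq_resolvent_delta_le
    (isSelfAdjoint_hoppingOperator a ⟨Λ, ha⟩) hz m F
  rcases Nat.eq_zero_or_pos k with rfl | hk
  · calc _ = ∑ n ∈ F, ‖resolvent (hoppingOperator a ⟨Λ, ha⟩) z (delta s) n‖ ^ 2 := by
          simp [transferMatrix]
      _ ≤ 1 * |z.im|⁻¹ ^ 4 := by
          rw [one_mul]
          exact (hsum s).trans (pow_le_pow_right₀ hρ (by norm_num))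
      _ ≤ 2 * (Λ + 1) ^ 2 * |z.im|⁻¹ ^ 4 := by
          gcongr
          nlinarith
  · have hdec (n : ℤ) (hn : n ∈ F) := resolvent_delta_apply_eq_cutBond_mul ⟨Λ, ha⟩ hz
      (show s ≤ k by lia) (hF n hn)
    rw [Finset.sum_congr rfl fun n hn => by rw [hdec n hn, norm_mul, mul_pow], ← Finset.mul_sum,
      ← mul_assoc]
    calc _ ≤ 2 * (Λ + 1) ^ 2 * |z.im|⁻¹ ^ 2 * |z.im|⁻¹ ^ 2 := mul_le_mul
          (norm_sq_row_zero_transferMatrix_mul_cutBond_le ha ha₀ hz hz₁ hs hk) (hsum _)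
          (by positivity) (by positivity)
      _ = 2 * (Λ + 1) ^ 2 * |z.im|⁻¹ ^ 4 := by ring

lemma maxTransferNormSq_mul_sum_le (hs : s ≤ 1) {N : ℕ} (hN : 1 ≤ N) {F : Finset ℤ}
    (hF : ∀ n ∈ F, (N : ℤ) < n) :
    maxTransferNormSq a N hN z
        * ∑ n ∈ F, ‖resolvent (hoppingOperator a ⟨Λ, ha⟩) z (delta s) n‖ ^ 2
      ≤ 2 * (1 + Λ ^ 2) * (Λ + 1) ^ 2 * |z.im|⁻¹ ^ 4 := by
  obtain ⟨k, hk, hmax⟩ := Finset.exists_mem_eq_sup' (Finset.nonempty_Icc.mpr hN)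
    fun n => ‖transferMatrix a n z‖ ^ 2
  rw [maxTransferNormSq, hmax]
  obtain ⟨hk₁, hkN⟩ := Finset.mem_Icc.1 hk
  obtain ⟨k, rfl⟩ := Nat.exists_eq_add_of_le' hk₁
  set S := ∑ n ∈ F, ‖resolvent (hoppingOperator a ⟨Λ, ha⟩) z (delta s) n‖ ^ 2
  have hrow (m : ℕ) (hm : m ≤ N) := norm_sq_row_zero_transferMatrix_mul_sum_le ha ha₀ hz hz₁ hs m
    fun n hn => (Nat.cast_le.2 hm).trans_lt (hF n hn)
  calc _ ≤ _ * S := mul_le_mul_of_nonneg_right (norm_sq_transferMatrix_succ_le ha₀ k z)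
        (by positivity)
    _ = (‖transferMatrix a (k + 1) z 0 0‖ ^ 2 + ‖transferMatrix a (k + 1) z 0 1‖ ^ 2) * S
        + |a (k + 1)| ^ 2
          * ((‖transferMatrix a k z 0 0‖ ^ 2 + ‖transferMatrix a k z 0 1‖ ^ 2) * S) := by
        rw [sq_abs]
        ring
    _ ≤ 2 * (Λ + 1) ^ 2 * |z.im|⁻¹ ^ 4 + Λ ^ 2 * (2 * (Λ + 1) ^ 2 * |z.im|⁻¹ ^ 4) := by
        refine add_le_add (hrow _ hkN) (mul_le_mul ?_ (hrow _ (by lia)) (by positivity)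
          (by positivity))
        gcongr
        exact ha _
    _ = 2 * (1 + Λ ^ 2) * (Λ + 1) ^ 2 * |z.im|⁻¹ ^ 4 := by ring

end HalfLine

section Reflection

/-- The reflection `ψ ↦ (n ↦ ψ (-n))` of `ℓ²(ℤ)`, which exchanges the two half-lines. -/
def siteReflection : EllTwo →ₗ[ℂ] EllTwo where
  toFun ψ := ⟨fun n => ψ (-n), memℓp_gen <| (Equiv.neg ℤ).summable_iff.2 <|
    (lp.memℓp ψ).summable (by norm_num)⟩
  map_add' _ _ := rfl
  map_smul' _ _ := rfl

lemma siteReflection_apply (ψ : EllTwo) (n : ℤ) : siteReflection ψ n = ψ (-n) := rfl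

lemma siteReflection_delta (s : ℤ) : siteReflection (delta s) = delta (-s) := by
  ext n
  simp only [siteReflection_apply, delta_apply, neg_eq_iff_eq_neg]

/-- The hopping sequence seen from the reflected lattice `n ↦ -n`, which maps the bond
`(n, n + 1)` to `(-n - 1, -n)`. -/
def reflectedHopping (a : ℤ → ℝ) (n : ℤ) : ℝ := a (-n - 1)

variable {a : ℤ → ℝ}

lemma siteReflection_hoppingOperator (ha : ∃ C : ℝ, ∀ n, |a n| ≤ C)
    (ha' : ∃ C : ℝ, ∀ n, |reflectedHopping a n| ≤ C) (ψ : EllTwo) :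
    siteReflection (hoppingOperator a ha ψ)
      = hoppingOperator (reflectedHopping a) ha' (siteReflection ψ) := by
  ext n
  simp only [siteReflection_apply, hoppingOperator_apply, reflectedHopping, neg_add', neg_sub',
    sub_neg_eq_add, add_sub_cancel_right]
  ring

/-- The smaller of the quantities `max_{1 ≤ n ≤ N} ‖Φ(n,z)‖²` of the right half-line and of the
reflected left half-line; it controls the resolvent outside `[-N, N]`. -/
def twoSidedTransferNormSq (a : ℤ → ℝ) (N : ℕ) (hN : 1 ≤ N) (z : ℂ) : ℝ :=
  min (maxTransferNormSq a N hN z) (maxTransferNormSq (reflectedHopping a) N hN z)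

lemma twoSidedTransferNormSq_pos (ha₀ : ∀ n, a n ≠ 0) (N : ℕ) (hN : 1 ≤ N) (z : ℂ) :
    0 < twoSidedTransferNormSq a N hN z :=
  lt_min (maxTransferNormSq_pos ha₀ N hN z)
    (maxTransferNormSq_pos (a := reflectedHopping a) (fun n => ha₀ (-n - 1)) N hN z)

lemma continuous_twoSidedTransferNormSq (a : ℤ → ℝ) (N : ℕ) (hN : 1 ≤ N) :
    Continuous (twoSidedTransferNormSq a N hN) :=
  (continuous_maxTransferNormSq a N hN).min (continuous_maxTransferNormSq _ N hN)

variable {Λ : ℝ} (ha : ∀ n, |a n| ≤ Λ) (ha₀ : ∀ n, a n ≠ 0) {z : ℂ} (hz : z.im ≠ 0)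
  (hz₁ : |z.im| ≤ 1) {s : ℤ}
include ha ha₀ hz hz₁

lemma maxTransferNormSq_reflectedHopping_mul_sum_le (hs : -1 ≤ s) {N : ℕ} (hN : 1 ≤ N)
    {F : Finset ℤ} (hF : ∀ n ∈ F, (N : ℤ) < -n) :
    maxTransferNormSq (reflectedHopping a) N hN z
        * ∑ n ∈ F, ‖resolvent (hoppingOperator a ⟨Λ, ha⟩) z (delta s) n‖ ^ 2
      ≤ 2 * (1 + Λ ^ 2) * (Λ + 1) ^ 2 * |z.im|⁻¹ ^ 4 := by
  have ha' (n : ℤ) : |reflectedHopping a n| ≤ Λ := ha _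
  have h := maxTransferNormSq_mul_sum_le ha' (fun n => ha₀ (-n - 1)) hz hz₁ (s := -s) (by lia) hN
    (F := F.map (Equiv.neg ℤ).toEmbedding) (by simpa using fun n hn => hF (-n) hn)
  rw [← siteReflection_delta, resolvent_apply_of_intertwines
    (siteReflection_hoppingOperator ⟨Λ, ha⟩ ⟨Λ, ha'⟩) (notMem_spectrum_hoppingOperator a _ hz)
    (notMem_spectrum_hoppingOperator _ _ hz), Finset.sum_map] at h
  simpa only [Equiv.coe_toEmbedding, Equiv.neg_apply, siteReflection_apply, neg_neg] using h

lemma twoSidedTransferNormSq_mul_sum_le (hs : |s| ≤ 1) {N : ℕ} (hN : 1 ≤ N) {F : Finset ℤ}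
    (hF : ∀ n ∈ F, (N : ℤ) < |n|) :
    twoSidedTransferNormSq a N hN z
        * ∑ n ∈ F, ‖resolvent (hoppingOperator a ⟨Λ, ha⟩) z (delta s) n‖ ^ 2
      ≤ 4 * (1 + Λ ^ 2) * (Λ + 1) ^ 2 * |z.im|⁻¹ ^ 4 := by
  obtain ⟨hs₁, hs₂⟩ := abs_le.1 hs
  have hright := maxTransferNormSq_mul_sum_le ha ha₀ hz hz₁ hs₂ hN (F := F.filter (0 < ·))
    fun n hn => by
      obtain ⟨hnF, hn₀⟩ := Finset.mem_filter.1 hn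
      simpa only [abs_of_pos hn₀] using hF n hnF
  have hleft := maxTransferNormSq_reflectedHopping_mul_sum_le ha ha₀ hz hz₁ hs₁ hN
    (F := F.filter (¬ 0 < ·)) fun n hn => by
      obtain ⟨hnF, hn₀⟩ := Finset.mem_filter.1 hn
      simpa only [abs_of_nonpos (not_lt.1 hn₀)] using hF n hnF
  rw [← Finset.sum_filter_add_sum_filter_not F (0 < ·), mul_add]
  calc _ ≤ 2 * (1 + Λ ^ 2) * (Λ + 1) ^ 2 * |z.im|⁻¹ ^ 4
        + 2 * (1 + Λ ^ 2) * (Λ + 1) ^ 2 * |z.im|⁻¹ ^ 4 := by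
        refine add_le_add (le_trans ?_ hright) (le_trans ?_ hleft) <;> gcongr
        exacts [min_le_left _ _, min_le_right _ _]
    _ = 4 * (1 + Λ ^ 2) * (Λ + 1) ^ 2 * |z.im|⁻¹ ^ 4 := by ring

end Reflection

section Contour

open Complex Set Interval

/-- The integrand `e^{-itz} ⟨δ_n, (z - H)⁻¹ δ_1⟩` whose contour integrals around `σ(H)` are
`2πi ⟨δ_n, e^{-itH} δ_1⟩`. -/
def evolutionIntegrand (H : EllTwo →L[ℂ] EllTwo) (t : ℝ) (n : ℤ) (z : ℂ) : ℂ :=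
  exp (-(I * t) * z) * inner ℂ (delta n) (resolvent H z (delta 1))

lemma rectIntegral_evolutionIntegrand {H : EllTwo →L[ℂ] EllTwo} (hH : IsStarNormal H)
    {x₀ x₁ y₀ y₁ : ℝ} (hσ : spectrum ℂ H ⊆ Ioo x₀ x₁ ×ℂ Ioo y₀ y₁) (t : ℝ) (n : ℤ) :
    rectIntegral (evolutionIntegrand H t n) x₀ x₁ y₀ y₁
      = 2 * Real.pi * I * inner ℂ (delta n) (evolution H t (delta 1)) := by
  set entry : (EllTwo →L[ℂ] EllTwo) →L[ℂ] ℂ :=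
    (innerSL ℂ (delta n)).comp (ContinuousLinearMap.apply ℂ EllTwo (delta 1))
  have hcont : ContinuousOn (fun z => exp (-(I * t) * z) • resolvent H z)
      (rectBoundary x₀ x₁ y₀ y₁) := ContinuousOn.smul
    (f := fun z => exp (-(I * t) * z)) (by fun_prop) <|
      (continuousOn_resolvent H).mono (disjoint_rectBoundary.mono_right hσ).subset_compl_right
  calc rectIntegral (evolutionIntegrand H t n) x₀ x₁ y₀ y₁
      = entry (rectIntegral (fun z => exp (-(I * t) * z) • resolvent H z) x₀ x₁ y₀ y₁) := by
        rw [← rectIntegral_clm_comp entry hcont]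
        exact rectIntegral_congr fun z _ => (map_smul entry _ _).symm
    _ = entry ((2 * Real.pi * I : ℂ) • evolution H t) := by
        rw [rectIntegral_smul_resolvent hH hσ (by fun_prop), cfc_cexp_mul hH, evolution]
    _ = 2 * Real.pi * I * inner ℂ (delta n) (evolution H t (delta 1)) := map_smul entry _ _

lemma norm_evolutionIntegrand (H : EllTwo →L[ℂ] EllTwo) (t : ℝ) (n : ℤ) (z : ℂ) :
    ‖evolutionIntegrand H t n z‖ = Real.exp (t * z.im) * ‖resolvent H z (delta 1) n‖ := by
  rw [evolutionIntegrand, norm_mul, norm_exp, inner_delta]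
  simp

lemma continuous_evolutionIntegrand_horizontal {H : EllTwo →L[ℂ] EllTwo} (hH : IsSelfAdjoint H)
    (t : ℝ) (n : ℤ) {y : ℝ} (hy : y ≠ 0) :
    Continuous fun E : ℝ => evolutionIntegrand H t n (E + y * I) := by
  have hR : Continuous fun E : ℝ => resolvent H (E + y * I) :=
    (continuousOn_resolvent H).comp_continuous (by fun_prop) fun E =>
      notMem_spectrum_of_im_ne_zero hH (by simpa using hy)
  unfold evolutionIntegrand
  fun_prop

lemma one_le_norm_sub_of_mem_spectrum {A : Type*} [Ring A] [Algebra ℂ A] {H : A} {K : ℝ}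
    (hσ : spectrum ℂ H ⊆ (fun x : ℝ => (x : ℂ)) '' Icc (-K + 1) (K - 1)) {z : ℂ}
    (hz : K ≤ |z.re| ∨ 1 ≤ |z.im|) {x : ℂ} (hx : x ∈ spectrum ℂ H) : 1 ≤ ‖z - x‖ := by
  obtain ⟨x, ⟨hx₁, hx₂⟩, rfl⟩ := hσ hx
  rcases hz with hz | hz
  · refine le_trans ?_ (abs_re_le_norm _)
    rw [sub_re, ofReal_re]
    have hxK : |x| ≤ K - 1 := abs_le.2 ⟨by linarith, hx₂⟩
    linarith [abs_sub_abs_le_abs_sub z.re x]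
  · refine le_trans ?_ (abs_im_le_norm _)
    rwa [sub_im, ofReal_im, sub_zero]

lemma spectrum_subset_reProdIm {A : Type*} [Ring A] [Algebra ℂ A] {H : A} {K : ℝ}
    (hσ : spectrum ℂ H ⊆ (fun x : ℝ => (x : ℂ)) '' Icc (-K + 1) (K - 1)) {y₀ y₁ : ℝ}
    (hy₀ : y₀ < 0) (hy₁ : 0 < y₁) : spectrum ℂ H ⊆ Ioo (-K) K ×ℂ Ioo y₀ y₁ := fun z hz => by
  obtain ⟨x, ⟨hx₁, hx₂⟩, rfl⟩ := hσ hz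
  exact ⟨⟨by rw [ofReal_re]; linarith, by rw [ofReal_re]; linarith⟩,
    ⟨by rwa [ofReal_im], by rwa [ofReal_im]⟩⟩

lemma norm_sq_le_add_of_two_pi_mul_norm_le {c : ℂ} {x y : ℝ} (h : 2 * Real.pi * ‖c‖ ≤ x + y) :
    ‖c‖ ^ 2 ≤ x ^ 2 + y ^ 2 := by
  have h₂ : 2 * ‖c‖ ≤ x + y := by nlinarith [Real.pi_gt_three, norm_nonneg c]
  nlinarith [sq_nonneg (x - y), norm_nonneg c]

variable {a : ℤ → ℝ} {Λ η K t : ℝ} (ha : ∀ n, |a n| ≤ Λ)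

lemma norm_evolutionIntegrand_le_exp (hη : 0 ≤ η) (hΛη : 2 * Λ * (Real.exp η - 1) ≤ 1 / 2)
    {z : ℂ} (hz : ∀ x ∈ spectrum ℂ (hoppingOperator a ⟨Λ, ha⟩), 1 ≤ ‖z - x‖)
    (ht : t * z.im ≤ 1) (n : ℤ) :
    ‖evolutionIntegrand (hoppingOperator a ⟨Λ, ha⟩) t n z‖
      ≤ 2 * Real.exp 1 * Real.exp (-(η * |(n : ℝ) - 1|)) := by
  have hR : ‖resolvent (hoppingOperator a ⟨Λ, ha⟩) z‖ ≤ 1 := by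
    simpa using norm_resolvent_le (isSelfAdjoint_hoppingOperator a ⟨Λ, ha⟩).isStarNormal
      one_pos hz
  have hzσ : z ∉ spectrum ℂ (hoppingOperator a ⟨Λ, ha⟩) := fun h => by
    simpa using (hz z h).trans_lt' one_pos
  have hΛ : 0 ≤ 2 * Λ * (Real.exp η - 1) := mul_nonneg
    (mul_nonneg zero_le_two ((abs_nonneg _).trans (ha 0))) (sub_nonneg.2 (Real.one_le_exp hη))
  have h := norm_resolvent_jacobiOperator_delta_apply_le ha ⟨0, fun _ => by simp⟩ hη hzσ
    ((mul_le_of_le_one_right hΛ hR).trans hΛη) 1 n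
  rw [Int.cast_one] at h
  calc _ = Real.exp (t * z.im) * ‖resolvent (hoppingOperator a ⟨Λ, ha⟩) z (delta 1) n‖ :=
        norm_evolutionIntegrand ..
    _ ≤ Real.exp 1 * (2 * 1 * Real.exp (-(η * |(n : ℝ) - 1|))) := by
        gcongr
        refine h.trans ?_
        gcongr
        exact hR
    _ = 2 * Real.exp 1 * Real.exp (-(η * |(n : ℝ) - 1|)) := by ring

variable (hη : 0 ≤ η) (hΛη : 2 * Λ * (Real.exp η - 1) ≤ 1 / 2)
  (hσ : spectrum ℂ (hoppingOperator a ⟨Λ, ha⟩)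
    ⊆ (fun x : ℝ => (x : ℂ)) '' Icc (-K + 1) (K - 1))
include hη hΛη hσ

lemma norm_integral_evolutionIntegrand_horizontal_le (hK : 0 ≤ K) {y : ℝ} (hy : 1 ≤ |y|)
    (hty : t * y ≤ 1) (n : ℤ) :
    ‖∫ E in (-K)..K, evolutionIntegrand (hoppingOperator a ⟨Λ, ha⟩) t n (E + y * I)‖
      ≤ 2 * K * (2 * Real.exp 1 * Real.exp (-(η * |(n : ℝ) - 1|))) := by
  refine (intervalIntegral.norm_integral_le_of_norm_le_const fun E _ =>
    norm_evolutionIntegrand_le_exp ha hη hΛη (fun x hx =>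
      one_le_norm_sub_of_mem_spectrum hσ (.inr (by simpa using hy)) hx)
      (by simpa using hty) n).trans_eq ?_
  rw [abs_of_nonneg (by linarith : 0 ≤ K - -K)]
  ring

lemma norm_integral_evolutionIntegrand_vertical_le {x y : ℝ} (hx : K ≤ |x|) (ht : 0 ≤ t)
    (hy₀ : -1 ≤ y) (hy₁ : y ≤ 1) (hty : t * y ≤ 1) (n : ℤ) :
    ‖∫ s in (-1)..y, evolutionIntegrand (hoppingOperator a ⟨Λ, ha⟩) t n (x + s * I)‖
      ≤ 2 * (2 * Real.exp 1 * Real.exp (-(η * |(n : ℝ) - 1|))) := by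
  refine (intervalIntegral.norm_integral_le_of_norm_le_const fun s hs =>
    norm_evolutionIntegrand_le_exp ha hη hΛη (fun x' hx' =>
      one_le_norm_sub_of_mem_spectrum hσ (.inl (by simpa using hx)) hx') ?_ n).trans ?_
  · rw [uIoc_of_le hy₀] at hs
    simpa using (mul_le_mul_of_nonneg_left hs.2 ht).trans hty
  · rw [abs_of_nonneg (by linarith : 0 ≤ y - -1), mul_comm]
    gcongr
    linarith

lemma siteProb_hoppingOperator_le (hK : 0 ≤ K) (ht : 0 ≤ t) {y : ℝ} (hy₀ : 0 < y) (hy₁ : y ≤ 1)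
    (hty : t * y ≤ 1) (n : ℤ) :
    siteProb (hoppingOperator a ⟨Λ, ha⟩) n t
      ≤ ‖∫ E in (-K)..K, evolutionIntegrand (hoppingOperator a ⟨Λ, ha⟩) t n (E + y * I)‖ ^ 2
        + ((2 * K + 4) * (2 * Real.exp 1)) ^ 2 * Real.exp (-(η * |(n : ℝ) - 1|)) ^ 2 := by
  set H := hoppingOperator a ⟨Λ, ha⟩
  set f := evolutionIntegrand H t n with hf
  have hbottom : ‖∫ E in (-K)..K, f (E + (-1 : ℝ) * I)‖ ≤ _ :=
    norm_integral_evolutionIntegrand_horizontal_le ha hη hΛη hσ hK (by simp) (by linarith) n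
  have hside (x : ℝ) (hx : K ≤ |x|) : ‖∫ s in (-1)..y, f (x + s * I)‖ ≤ _ :=
    norm_integral_evolutionIntegrand_vertical_le ha hη hΛη hσ hx ht (by linarith) hy₁ hty n
  have hrect := norm_rectIntegral_le f (-K) K (-1) y
  rw [hf, rectIntegral_evolutionIntegrand (isSelfAdjoint_hoppingOperator a ⟨Λ, ha⟩).isStarNormal
    (spectrum_subset_reProdIm hσ (by norm_num) hy₀), ← hf] at hrect
  have hnorm : ‖(2 * Real.pi * I : ℂ)‖ = 2 * Real.pi := by simp [abs_of_pos Real.pi_pos]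
  rw [norm_mul, hnorm] at hrect
  rw [← mul_pow]
  refine norm_sq_le_add_of_two_pi_mul_norm_le (hrect.trans ?_)
  linarith [hside K (le_abs_self K), hside (-K) (abs_neg K ▸ le_abs_self K)]

end Contour

section TopSide

open Complex MeasureTheory

lemma norm_intervalIntegral_sq_le {E : Type*} [NormedAddCommGroup E] [NormedSpace ℝ E]
    [CompleteSpace E] {f : ℝ → E} {a b : ℝ} (hab : a ≤ b) (hf : IntervalIntegrable f volume a b)
    (hf₂ : IntervalIntegrable (fun x => ‖f x‖ ^ 2) volume a b) :
    ‖∫ x in a..b, f x‖ ^ 2 ≤ (b - a) * ∫ x in a..b, ‖f x‖ ^ 2 := by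
  rcases hab.eq_or_lt with rfl | hlt
  · simp
  have hvol : volume.real (Set.Ioc a b) = b - a := Real.volume_real_Ioc_of_le hab
  have hpos : 0 < b - a := sub_pos.2 hlt
  have hjensen := (convexOn_univ_norm (E := E).pow (fun _ _ => norm_nonneg _) 2).map_set_average_le
    (t := Set.Ioc a b) (μ := volume) (f := f) (by fun_prop) isClosed_univ (by simp [hlt])
    (by simp) (by simp) hf.1 hf₂.1
  rw [setAverage_eq, setAverage_eq, hvol] at hjensen
  rw [intervalIntegral.integral_of_le hab, intervalIntegral.integral_of_le hab]
  simp only [Pi.pow_apply, norm_smul, norm_inv, Real.norm_of_nonneg hpos.le, mul_pow,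
    smul_eq_mul] at hjensen
  field_simp at hjensen
  exact hjensen

lemma sum_norm_intervalIntegral_sq_le {ι E : Type*} [NormedAddCommGroup E] [NormedSpace ℝ E]
    [CompleteSpace E] {f : ι → ℝ → E} (hf : ∀ i, Continuous (f i)) (F : Finset ι) {a b : ℝ}
    (hab : a ≤ b) :
    ∑ i ∈ F, ‖∫ x in a..b, f i x‖ ^ 2 ≤ (b - a) * ∫ x in a..b, ∑ i ∈ F, ‖f i x‖ ^ 2 := by
  have hf₂ (i : ι) : IntervalIntegrable (fun x => ‖f i x‖ ^ 2) volume a b :=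
    ((hf i).norm.pow 2).intervalIntegrable _ _
  rw [intervalIntegral.integral_finsetSum fun i _ => hf₂ i, Finset.mul_sum]
  exact Finset.sum_le_sum fun i _ =>
    norm_intervalIntegral_sq_le hab ((hf i).intervalIntegrable _ _) (hf₂ i)

variable {a : ℤ → ℝ} {Λ K t : ℝ} (ha : ∀ n, |a n| ≤ Λ) (ha₀ : ∀ n, a n ≠ 0)
include ha₀

lemma sum_norm_sq_evolutionIntegrand_le (ht : 1 ≤ t) {N : ℕ} (hN : 1 ≤ N)
    {F : Finset ℤ} (hF : ∀ n ∈ F, (N : ℤ) < |n|) {z : ℂ} (hz : z.im = t⁻¹) :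
    ∑ n ∈ F, ‖evolutionIntegrand (hoppingOperator a ⟨Λ, ha⟩) t n z‖ ^ 2
      ≤ Real.exp 1 ^ 2 * (4 * (1 + Λ ^ 2) * (Λ + 1) ^ 2 * t ^ 4)
        * (twoSidedTransferNormSq a N hN z)⁻¹ := by
  have ht₀ : 0 < t := one_pos.trans_le ht
  have him : |z.im| = t⁻¹ := by rw [hz, abs_of_pos (inv_pos.2 ht₀)]
  have h := twoSidedTransferNormSq_mul_sum_le ha ha₀ (z := z) (by rw [hz]; positivity)
    (him ▸ inv_le_one_of_one_le₀ ht) (s := 1) (by simp) hN hF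
  rw [him, inv_inv] at h
  simp only [norm_evolutionIntegrand, hz, mul_inv_cancel₀ ht₀.ne', mul_pow, ← Finset.mul_sum]
  rw [mul_assoc]
  gcongr
  rwa [← div_eq_mul_inv, le_div_iff₀' (twoSidedTransferNormSq_pos ha₀ N hN z)]

lemma sum_norm_integral_evolutionIntegrand_sq_le (hK : 0 ≤ K) (ht : 1 ≤ t) {N : ℕ} (hN : 1 ≤ N)
    {F : Finset ℤ} (hF : ∀ n ∈ F, (N : ℤ) < |n|) :
    ∑ n ∈ F, ‖∫ E in (-K)..K,
        evolutionIntegrand (hoppingOperator a ⟨Λ, ha⟩) t n (E + (t⁻¹ : ℝ) * I)‖ ^ 2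
      ≤ 2 * K * (Real.exp 1 ^ 2 * (4 * (1 + Λ ^ 2) * (Λ + 1) ^ 2 * t ^ 4)
        * ∫ E in (-K)..K, (twoSidedTransferNormSq a N hN (E + I / t))⁻¹) := by
  have hKK : -K ≤ K := by linarith
  have hcont := fun n => continuous_evolutionIntegrand_horizontal
    (isSelfAdjoint_hoppingOperator a ⟨Λ, ha⟩) t n (inv_ne_zero (one_pos.trans_le ht).ne')
  have htop (E : ℝ) : (E + (t⁻¹ : ℝ) * I : ℂ) = E + I / t := by
    rw [ofReal_inv, div_eq_inv_mul]
  have hweight : Continuous fun E : ℝ => (twoSidedTransferNormSq a N hN (E + I / t))⁻¹ :=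
    ((continuous_twoSidedTransferNormSq a N hN).comp (by fun_prop)).inv₀ fun E =>
      (twoSidedTransferNormSq_pos ha₀ N hN _).ne'
  calc _ ≤ (K - -K) * ∫ E in (-K)..K, ∑ n ∈ F,
        ‖evolutionIntegrand (hoppingOperator a ⟨Λ, ha⟩) t n (E + (t⁻¹ : ℝ) * I)‖ ^ 2 :=
        sum_norm_intervalIntegral_sq_le hcont F hKK
    _ ≤ (K - -K) * ∫ E in (-K)..K, Real.exp 1 ^ 2 * (4 * (1 + Λ ^ 2) * (Λ + 1) ^ 2 * t ^ 4)
        * (twoSidedTransferNormSq a N hN (E + I / t))⁻¹ := by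
        gcongr
        refine intervalIntegral.integral_mono_on hKK
          ((continuous_finsetSum _ fun n _ => (hcont n).norm.pow 2).intervalIntegrable _ _)
          ((hweight.const_mul _).intervalIntegrable _ _) fun E _ => ?_
        rw [← htop]
        exact sum_norm_sq_evolutionIntegrand_le ha ha₀ ht hN hF (by simp)
    _ = _ := by
        rw [intervalIntegral.integral_const_mul]
        ring

end TopSide

section OutsideProbability

open Complex Set

lemma exists_pos_mul_exp_sub_one_le (c : ℝ) {ε : ℝ} (hε : 0 < ε) :
    ∃ η > 0, c * (Real.exp η - 1) ≤ ε := by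
  have hcont : Continuous fun η => c * (Real.exp η - 1) := by fun_prop
  have hsmall : ∀ᶠ η in nhdsWithin 0 (Ioi 0), c * (Real.exp η - 1) < ε :=
    (hcont.continuousWithinAt.eventually_lt continuousWithinAt_const (by simpa using hε))
  obtain ⟨η, hle, hη⟩ := (hsmall.and self_mem_nhdsWithin).exists
  exact ⟨η, hη, hle.le⟩

lemma summable_exp_neg_mul_abs_int {η : ℝ} (hη : 0 < η) :
    Summable fun n : ℤ => Real.exp (-η * |(n : ℝ)|) := by
  have h : Summable fun n : ℕ => Real.exp (-η * n) := by
    simpa only [mul_comm] using Real.summable_exp_nat_mul_iff.2 (neg_lt_zero.2 hη)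
  exact .of_nat_of_neg (by simpa using h) (by simpa using h)

lemma exists_sum_exp_neg_mul_abs_sub_one_sq_le {η : ℝ} (hη : 0 < η) :
    ∃ S > 0, ∀ (N : ℕ) (F : Finset ℤ), (∀ n ∈ F, (N : ℤ) < |n|) →
      ∑ n ∈ F, Real.exp (-(η * |(n : ℝ) - 1|)) ^ 2 ≤ S * Real.exp (-η * N) := by
  have hsum := summable_exp_neg_mul_abs_int hη
  refine ⟨Real.exp η ^ 2 * ∑' n : ℤ, Real.exp (-η * |(n : ℝ)|),
    mul_pos (by positivity) (hsum.tsum_pos (fun n => (Real.exp_pos _).le) 0 (Real.exp_pos _)),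
    fun N F hF => ?_⟩
  have hterm (n : ℤ) (hn : n ∈ F) : Real.exp (-(η * |(n : ℝ) - 1|)) ^ 2
      ≤ Real.exp η ^ 2 * Real.exp (-η * N) * Real.exp (-η * |(n : ℝ)|) := by
    have hN : (N : ℝ) ≤ |(n : ℝ)| := by exact_mod_cast (hF n hn).le
    have htri : |(n : ℝ)| ≤ |(n : ℝ) - 1| + 1 := by simpa using abs_add_le ((n : ℝ) - 1) 1
    rw [← Real.exp_nat_mul, ← Real.exp_nat_mul, ← Real.exp_add, ← Real.exp_add, Real.exp_le_exp]
    push_cast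
    nlinarith
  calc _ ≤ ∑ n ∈ F, Real.exp η ^ 2 * Real.exp (-η * N) * Real.exp (-η * |(n : ℝ)|) :=
        Finset.sum_le_sum hterm
    _ ≤ Real.exp η ^ 2 * Real.exp (-η * N) * ∑' n : ℤ, Real.exp (-η * |(n : ℝ)|) := by
        rw [← Finset.mul_sum]
        gcongr
        exact hsum.sum_le_tsum F fun n _ => (Real.exp_pos _).le
    _ = _ := by ring

lemma outsideProb_le_of_sum_le {H : EllTwo →L[ℂ] EllTwo} {N : ℕ} {t c : ℝ}
    (h : ∀ F : Finset ℤ, (∀ n ∈ F, (N : ℤ) < |n|) → ∑ n ∈ F, siteProb H n t ≤ c) :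
    outsideProb H N t ≤ c := by
  refine Real.tsum_le_of_sum_le (fun n => sq_nonneg _) fun G => ?_
  have hG : ∀ n ∈ G.map (Function.Embedding.subtype _), (N : ℤ) < |n| := fun n hn => by
    obtain ⟨m, -, rfl⟩ := Finset.mem_map.1 hn
    exact m.2
  simpa using h _ hG

variable {a : ℤ → ℝ} {Λ η K t : ℝ} (ha : ∀ n, |a n| ≤ Λ) (hη : 0 ≤ η)
  (hΛη : 2 * Λ * (Real.exp η - 1) ≤ 1 / 2) (hK : 0 ≤ K)
  (hσ : spectrum ℂ (hoppingOperator a ⟨Λ, ha⟩)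
    ⊆ (fun x : ℝ => (x : ℂ)) '' Icc (-K + 1) (K - 1))
include hη hΛη hK hσ

lemma sum_siteProb_hoppingOperator_le_of_le_one (ht : 0 ≤ t) (ht₁ : t ≤ 1) (F : Finset ℤ) :
    ∑ n ∈ F, siteProb (hoppingOperator a ⟨Λ, ha⟩) n t
      ≤ 2 * ((2 * K + 4) * (2 * Real.exp 1)) ^ 2
        * ∑ n ∈ F, Real.exp (-(η * |(n : ℝ) - 1|)) ^ 2 := by
  rw [Finset.mul_sum]
  refine Finset.sum_le_sum fun n _ => ?_
  have hty : t * 1 ≤ 1 := by rwa [mul_one]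
  have htop : ‖∫ E in (-K)..K,
      evolutionIntegrand (hoppingOperator a ⟨Λ, ha⟩) t n (E + (1 : ℝ) * I)‖
        ≤ (2 * K + 4) * (2 * Real.exp 1) * Real.exp (-(η * |(n : ℝ) - 1|)) :=
    calc _ ≤ 2 * K * (2 * Real.exp 1 * Real.exp (-(η * |(n : ℝ) - 1|))) :=
          norm_integral_evolutionIntegrand_horizontal_le ha hη hΛη hσ hK (by simp) hty n
      _ ≤ (2 * K + 4) * (2 * Real.exp 1 * Real.exp (-(η * |(n : ℝ) - 1|))) := by
          gcongr
          norm_num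
      _ = _ := by ring
  have hsq := pow_le_pow_left₀ (norm_nonneg _) htop 2
  have hsite := siteProb_hoppingOperator_le ha hη hΛη hσ hK ht one_pos le_rfl hty n
  rw [mul_pow _ (Real.exp (-(η * _)))] at hsq
  linarith

lemma sum_siteProb_hoppingOperator_le_of_one_le (ha₀ : ∀ n, a n ≠ 0) (ht : 1 ≤ t) {N : ℕ}
    (hN : 1 ≤ N) {F : Finset ℤ} (hF : ∀ n ∈ F, (N : ℤ) < |n|) :
    ∑ n ∈ F, siteProb (hoppingOperator a ⟨Λ, ha⟩) n t
      ≤ 2 * K * (Real.exp 1 ^ 2 * (4 * (1 + Λ ^ 2) * (Λ + 1) ^ 2 * t ^ 4)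
          * ∫ E in (-K)..K, (twoSidedTransferNormSq a N hN (E + I / t))⁻¹)
        + ((2 * K + 4) * (2 * Real.exp 1)) ^ 2
          * ∑ n ∈ F, Real.exp (-(η * |(n : ℝ) - 1|)) ^ 2 := by
  have ht₀ : 0 < t := one_pos.trans_le ht
  refine (Finset.sum_le_sum fun n _ => siteProb_hoppingOperator_le ha hη hΛη hσ hK ht₀.le
    (inv_pos.2 ht₀) (inv_le_one_of_one_le₀ ht) (mul_inv_cancel₀ ht₀.ne').le n).trans ?_
  rw [Finset.sum_add_distrib, ← Finset.mul_sum]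
  gcongr
  exact sum_norm_integral_evolutionIntegrand_sq_le ha ha₀ hK ht hN hF

lemma outsideProb_hoppingOperator_le {S : ℝ} (ha₀ : ∀ n, a n ≠ 0) {N : ℕ} (hN : 1 ≤ N)
    (hS : ∀ F : Finset ℤ, (∀ n ∈ F, (N : ℤ) < |n|) →
      ∑ n ∈ F, Real.exp (-(η * |(n : ℝ) - 1|)) ^ 2 ≤ S) (ht : 0 ≤ t) :
    outsideProb (hoppingOperator a ⟨Λ, ha⟩) N t
      ≤ 2 * ((2 * K + 4) * (2 * Real.exp 1)) ^ 2 * S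
        + 2 * K * (Real.exp 1 ^ 2 * (4 * (1 + Λ ^ 2) * (Λ + 1) ^ 2 * t ^ 4)
          * ∫ E in (-K)..K, (twoSidedTransferNormSq a N hN (E + I / t))⁻¹) := by
  have hweight : 0 ≤ ∫ E in (-K)..K, (twoSidedTransferNormSq a N hN (E + I / t))⁻¹ :=
    intervalIntegral.integral_nonneg (by linarith) fun E _ =>
      (inv_pos.2 (twoSidedTransferNormSq_pos ha₀ N hN _)).le
  refine outsideProb_le_of_sum_le fun F hF => ?_
  rcases le_total t 1 with ht₁ | ht₁
  · refine (sum_siteProb_hoppingOperator_le_of_le_one ha hη hΛη hK hσ ht ht₁ F).trans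
      (le_add_of_le_of_nonneg ?_ (by positivity))
    gcongr
    exact hS F hF
  · refine (sum_siteProb_hoppingOperator_le_of_one_le ha hη hΛη hK hσ ha₀ ht₁ hN hF).trans ?_
    rw [add_comm]
    gcongr ?_ + _
    refine mul_le_mul ?_ (hS F hF) (by positivity) (by positivity)
    linarith [sq_nonneg ((2 * K + 4) * (2 * Real.exp 1))]

end OutsideProbability

theorem theorem3_general (Λ K : ℝ) (hK : 0 ≤ K) :
    ∃ C d : ℝ, 0 < C ∧ 0 < d ∧
      ∀ (a : ℤ → ℝ) (ha : ∀ n, |a n| ≤ Λ), (∀ n, a n ≠ 0) →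
        spectrum ℂ (hoppingOperator a ⟨Λ, ha⟩)
            ⊆ (fun x : ℝ => (x : ℂ)) '' Set.Icc (-K + 1) (K - 1) →
          ∀ (N : ℕ) (hN : 1 ≤ N) (t : ℝ), 0 < t →
            outsideProb (hoppingOperator a ⟨Λ, ha⟩) N t
              ≤ C * (Real.exp (-d * N)
                  + t ^ 4 * ∫ E in (-K)..K,
                      (twoSidedTransferNormSq a N hN ((E : ℂ) + Complex.I / (t : ℂ)))⁻¹) := by
  obtain ⟨η, hη, hΛη⟩ := exists_pos_mul_exp_sub_one_le (2 * Λ) one_half_pos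
  obtain ⟨S, hS₀, hS⟩ := exists_sum_exp_neg_mul_abs_sub_one_sq_le hη
  set A := 2 * ((2 * K + 4) * (2 * Real.exp 1)) ^ 2 * S
  set B := 2 * K * (Real.exp 1 ^ 2 * (4 * (1 + Λ ^ 2) * (Λ + 1) ^ 2))
  have hA : 0 < A := mul_pos (by positivity) hS₀
  have hB : 0 ≤ B := by positivity
  refine ⟨A + B, η, by positivity, hη, fun a ha ha₀ hσ N hN t ht => ?_⟩
  have hweight : 0 ≤ ∫ E in (-K)..K, (twoSidedTransferNormSq a N hN (E + Complex.I / t))⁻¹ :=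
    intervalIntegral.integral_nonneg (by linarith) fun E _ =>
      (inv_pos.2 (twoSidedTransferNormSq_pos ha₀ N hN _)).le
  set J := ∫ E in (-K)..K, (twoSidedTransferNormSq a N hN (E + Complex.I / t))⁻¹
  calc _ ≤ _ := outsideProb_hoppingOperator_le ha hη.le hΛη hK hσ ha₀ hN (hS N) ht.le
    _ = A * Real.exp (-η * N) + B * (t ^ 4 * J) := by ring
    _ ≤ (A + B) * Real.exp (-η * N) + (A + B) * (t ^ 4 * J) := by
        gcongr <;> linarith
    _ = _ := by ring

section Sturmian

variable {l₁ l₂ β : ℝ}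

lemma sturmianHopping_eq_or_eq (hβ : β ∈ Set.Icc (0 : ℝ) 1) (n : ℤ) :
    sturmianHopping l₁ l₂ β n = l₁ ∨ sturmianHopping l₁ l₂ β n = l₂ := by
  have hlow : ⌊(n : ℝ) * β⌋ ≤ ⌊((n : ℝ) + 1) * β⌋ := Int.floor_le_floor (by nlinarith [hβ.1])
  have hupp : ⌊((n : ℝ) + 1) * β⌋ ≤ ⌊(n : ℝ) * β⌋ + 1 := by
    rw [← Int.floor_add_one]
    exact Int.floor_le_floor (by nlinarith [hβ.2])
  obtain h | h : ⌊((n : ℝ) + 1) * β⌋ - ⌊(n : ℝ) * β⌋ = 1 ∨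
      ⌊((n : ℝ) + 1) * β⌋ - ⌊(n : ℝ) * β⌋ = 0 := by lia
  · exact .inl (by simp [sturmianHopping, h])
  · exact .inr (by simp [sturmianHopping, h])

lemma sturmianHopping_pos (hl₁ : 0 < l₁) (hl₂ : 0 < l₂) (hβ : β ∈ Set.Icc (0 : ℝ) 1) (n : ℤ) :
    0 < sturmianHopping l₁ l₂ β n := by
  rcases sturmianHopping_eq_or_eq hβ n with h | h <;> rwa [h]

lemma abs_sturmianHopping_le (hl₁ : 0 < l₁) (hl₂ : 0 < l₂) (hβ : β ∈ Set.Icc (0 : ℝ) 1) (n : ℤ) :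
    |sturmianHopping l₁ l₂ β n| ≤ max l₁ l₂ := by
  rw [abs_of_pos (sturmianHopping_pos hl₁ hl₂ hβ n)]
  rcases sturmianHopping_eq_or_eq (l₁ := l₁) (l₂ := l₂) hβ n with h | h <;> simp [h]

lemma floor_neg_of_irrational {x : ℝ} (hx : Irrational x) : ⌊-x⌋ = -⌊x⌋ - 1 := by
  have hlt : (⌊x⌋ : ℝ) < x := (Int.floor_le x).lt_of_ne' (hx.ne_int _)
  rw [Int.floor_eq_iff]
  push_cast
  constructor <;> linarith [Int.lt_floor_add_one x]

lemma sturmianHopping_neg_sub_one (hβ : Irrational β) {n : ℤ} (hn : 1 ≤ n) :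
    sturmianHopping l₁ l₂ β (-n - 1) = sturmianHopping l₁ l₂ β n := by
  have hirr : Irrational ((n : ℝ) * β) := hβ.intCast_mul (by lia)
  have hirr' : Irrational (((n : ℝ) + 1) * β) := by
    exact_mod_cast hβ.intCast_mul (m := n + 1) (by lia)
  have hsucc : (((-n - 1 : ℤ) : ℝ) + 1) * β = -((n : ℝ) * β) := by push_cast; ring
  have hself : ((-n - 1 : ℤ) : ℝ) * β = -(((n : ℝ) + 1) * β) := by push_cast; ring
  rw [sturmianHopping, sturmianHopping, hsucc, hself, floor_neg_of_irrational hirr,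
    floor_neg_of_irrational hirr']
  push_cast
  ring

-- The reflection `n ↦ -n - 1` fixes a Sturmian sequence away from `n ∈ {-1, 0}`, and the transfer
-- matrices only see the sites `n ≥ 1`.
lemma twoSidedTransferNormSq_sturmianHopping (hβ : Irrational β) {N : ℕ} (hN : 1 ≤ N) (z : ℂ) :
    twoSidedTransferNormSq (sturmianHopping l₁ l₂ β) N hN z
      = maxTransferNormSq (sturmianHopping l₁ l₂ β) N hN z := by
  have hreflect (n : ℤ) (hn : 1 ≤ n) :
      reflectedHopping (sturmianHopping l₁ l₂ β) n = sturmianHopping l₁ l₂ β n :=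
    sturmianHopping_neg_sub_one hβ hn
  simp only [twoSidedTransferNormSq, maxTransferNormSq, transferMatrix_congr hreflect, min_self]

end Sturmian

end

theorem theorem3 (l₁ l₂ K : ℝ) (hl₁ : 0 < l₁) (hl₂ : 0 < l₂) (hK : 4 ≤ K) :
    ∃ C d : ℝ, 0 < C ∧ 0 < d ∧
      ∀ β : ℝ, Irrational β → β ∈ Set.Icc (0 : ℝ) 1 →
        spectrum ℂ (sturmianOperator l₁ l₂ β)
            ⊆ (fun x : ℝ => (x : ℂ)) '' Set.Icc (-K + 1) (K - 1) →
          ∀ (N : ℕ) (hN : 1 ≤ N) (t : ℝ), 0 < t →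
            outsideProb (sturmianOperator l₁ l₂ β) N t
              ≤ C * (Real.exp (-d * N)
                  + t ^ 4 * ∫ E in (-K)..K,
                      (maxTransferNormSq (sturmianHopping l₁ l₂ β) N hN
                        ((E : ℂ) + Complex.I / (t : ℂ)))⁻¹) := by
  obtain ⟨C, d, hC, hd, hbound⟩ := theorem3_general (max l₁ l₂) K (by linarith)
  refine ⟨C, d, hC, hd, fun β hirr hβ hσ N hN t ht => ?_⟩
  simpa only [sturmianOperator, hoppingOperator, twoSidedTransferNormSq_sturmianHopping hirr] using
    hbound _ (abs_sturmianHopping_le hl₁ hl₂ hβ) (fun n => (sturmianHopping_pos hl₁ hl₂ hβ n).ne')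
      hσ N hN t ht
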